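/- **Setting.** Let $k\ge 2$, let $V$ be a finite set, and let $(k+1)^V$ be the set of $k$-tuples $\mathbf X=(X_1,\dots,X_k)$ of pairwise disjoint subsets of $V$. Let $f\colon(k+1)^V\to\mathbb R_{\ge 0}$ be $k$-submodular (not necessarily monotone): $f(\mathbf X)+f(\mathbf Y)\ge f(\mathbf X\sqcap\mathbf Y)+f(\mathbf X\sqcup\mathbf Y)$, where $(\mathbf X\sqcap\mathbf Y)_a=X_a\cap Y_a$ and $(\mathbf X\sqcup\mathbf Y)_a=(X_a\cup Y_a)\setminus\bigcup_{b\ne a}(X_b\cup Y_b)$. Let $\Delta_{t,a}f(\mathbf X)$ be the gain of adding $t\notin\bigcup_bX_b$ to $X_a$. Let $n_1,\dots,n_k\ge 1$ be budgets; a tuple is feasible if $|S_a|\le n_a$ for all $a$, and $\mathbf S^*$ is a feasible tuple of maximum value. Assume, without loss of generality, that $n_1=\max_a n_a$. The items of $V$ arrive one at a time in an arbitrary fixed order; all ties below are broken arbitrarily. For $d>0$ and an integer $n\ge1$ let $c(d,n)=\frac{1+d}{(1+d/n)^n-1}$, and for a finite family of weights let $\beta_{d,n}=\sum_{i=1}^n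 w(i)\,\frac{c(d,n)}{n}\left(1+\frac dn\right)^{i-1}$, where $w(i)$ is the $i$-th largest weight of the family ($0$ if there are fewer than $i$). **Solution $\mathbf A$.** Let $g(S)=f(S,\emptyset,\dots,\emptyset)$ and $N=n_1$. If $N\le 10$ put $p=0.3$ and let $d$ be $1$, $1.7961$, $2.0654$, $2.1627$, $2.2107$, $2.2387$, $2.2567$, $2.2692$, $2.2783$, $2.2852$ for $N=1,\dots,10$ respectively; if $N\ge 11$ put $d=1.9532$ and $p=\frac1{1+d}$. (This is the subsampled threshold algorithm for a partition matroid, in the case of one part.) Start with $S=\emptyset$, $\beta=0$. When $t$ arrives, let $w_t=g(S\cup\{t\})-g(S)$ and let $Z_t\sim\mathrm{Ber}(p)$ be a fresh independent coin. If $w_t\ge\beta$ and $Z_t=1$, then first, if $|S|=N$, remove from $S$ an item of least weight; then add $t$ to $S$ and set $\beta$ to $\beta_{d,N}$ of the weights $\{w_i:i\in S\}$. At the end put $\mathbf A=(S,\emptyset,\dots,\emptyset)$. Let $$\alpha_{\mathrm{nmp}}=\frac{1-p}{\max\left\{1+c(d,N)+d,\ \left(1-\frac1N\right)c(d,N)+\frac1p\right\}}.$$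 **Solution $\mathbf B$.** Let $\widehat n_1=\min\{n_1,\sum_{a\ge2}n_a\}$ and $\widehat n_a=n_a$ for $a\ge2$. Let $d_a=1,\ 1.0642,\ 1.0893$ if $\widehat n_a=1,2,3$, and $d_a=1.1461$ if $\widehat n_a\ge4$. Start with $\mathbf S=(\emptyset,\dots,\emptyset)$ and all $\beta_a=0$. When $t$ arrives, let $w_{t,a}=\Delta_{t,a}f(\mathbf S)$ for all $a$, and choose $a$ maximizing $w_{t,a}-\beta_a-\min_{a'\ne a}\beta_{a'}$. If $w_{t,a}\ge\beta_a$, then first, if $|S_a|=\widehat n_a$, remove from $S_a$ an item $i$ of least $w_{i,a}$; then add $t$ to $S_a$ and set $\beta_a$ to $\beta_{d_a,\widehat n_a}$ of the weights $\{w_{i,a}:i\in S_a\}$. The final tuple is $\mathbf B$. Let $$\alpha_{\mathrm{mon}}=\min_a\frac1{Q_a},\qquad Q_a=(1+d_a)\left(1+\frac1{(1+d_a/\widehat n_a)^{\widehat n_a}-1}\right).$$ **Theorem.** $\mathbf A$ (for every outcome of the coins) and $\mathbf B$ are feasible for the budgets $n_1,\dots,n_k$, and $$\mathbb E\left[\max\{f(\mathbf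 A),f(\mathbf B)\}\right]\ \ge\ \frac{1}{\frac1{\alpha_{\mathrm{nmp}}}+\frac2{\alpha_{\mathrm{mon}}}}\,f(\mathbf S^*).$$ The same lower bound holds for the expected value of the solution obtained by taking $\mathbf A$ with probability $q=\frac{1/\alpha_{\mathrm{nmp}}}{1/\alpha_{\mathrm{nmp}}+2/\alpha_{\mathrm{mon}}}$ and $\mathbf B$ otherwise, by a coin independent of the $Z_t$. Moreover $\alpha_{\mathrm{nmp}}\ge0.175$, and $\alpha_{\mathrm{nmp}}\ge0.1921\left(1-\frac{0.7676}{n_1}\right)$ if $n_1\ge11$; and $\alpha_{\mathrm{mon}}\ge0.25$, and $\alpha_{\mathrm{mon}}\ge0.3178\left(1-\frac{0.7681}{\min_an_a}\right)$ if $\min_an_a\ge4$. -/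

import Mathlib

open MeasureTheory ProbabilityTheory

/-- A `k`-tuple of pairwise disjoint (finite) subsets of `V`, i.e. an element of `(k+1)^V`. -/
@[ext]
structure KTuple (k : ℕ) (V : Type*) where
  part : Fin k → Finset V
  disj : ∀ a b, a ≠ b → Disjoint (part a) (part b)

namespace KTuple

variable {k : ℕ} {V : Type*} [DecidableEq V]

/-- The tuple `(∅, …, ∅)`. -/
def empty (k : ℕ) (V : Type*) : KTuple k V where
  part := fun _ => ∅
  disj := fun _ _ _ => Finset.disjoint_empty_left _

/-- The tuple `(∅, …, ∅, S, ∅, …, ∅)` with `S` as its part `a`. -/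
def single (a : Fin k) (S : Finset V) : KTuple k V where
  part := fun b => if b = a then S else ∅
  disj := by
    intro b c hbc
    by_cases hb : b = a
    · have hc : c ≠ a := fun h => hbc (hb.trans h.symm)
      simp [hc]
    · simp [hb]

/-- `(X ⊓ Y)_a = X_a ∩ Y_a`. -/
def meet (X Y : KTuple k V) : KTuple k V where
  part := fun a => X.part a ∩ Y.part a
  disj := fun a b hab =>
    Finset.disjoint_of_subset_left Finset.inter_subset_left
      (Finset.disjoint_of_subset_right Finset.inter_subset_left (X.disj a b hab))

/-- `(X ⊔ Y)_a = (X_a ∪ Y_a) \ ⋃_{b ≠ a} (X_b ∪ Y_b)`. -/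
def join (X Y : KTuple k V) : KTuple k V where
  part := fun a => (X.part a ∪ Y.part a) \
    (Finset.univ.erase a).biUnion (fun b => X.part b ∪ Y.part b)
  disj := by
    intro a b hab
    rw [Finset.disjoint_left]
    intro x hx hx'
    rw [Finset.mem_sdiff] at hx hx'
    exact hx'.2 (Finset.mem_biUnion.2 ⟨a, Finset.mem_erase.2 ⟨hab, Finset.mem_univ a⟩, hx.1⟩)

/-- Put item `t` into part `a`, `(X_1, …, X_a ∪ {t}, …, X_k)`. It is used only for items `t` that
lie in no part of `X`; for other items the erasure keeps the parts disjoint. -/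
def assign (X : KTuple k V) (t : V) (a : Fin k) : KTuple k V where
  part := fun b => if b = a then insert t (X.part b) else (X.part b).erase t
  disj := by
    intro b c hbc
    rw [Finset.disjoint_left]
    intro x hb hc
    have hd : x ∈ X.part b → x ∉ X.part c := fun h => Finset.disjoint_left.1 (X.disj b c hbc) h
    split_ifs at hb hc with h1 h2 h2
    · exact hbc (h1.trans h2.symm)
    · rw [Finset.mem_insert] at hb
      rw [Finset.mem_erase] at hc
      exact hb.elim hc.1 (fun h => hd h hc.2)
    · rw [Finset.mem_insert] at hc
      rw [Finset.mem_erase] at hb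
      exact hc.elim hb.1 (hd hb.2)
    · rw [Finset.mem_erase] at hb hc
      exact hd hb.2 hc.2

/-- Remove (dispose of) item `t`. -/
def remove (X : KTuple k V) (t : V) : KTuple k V where
  part := fun b => (X.part b).erase t
  disj := fun a b hab =>
    Finset.disjoint_of_subset_left (Finset.erase_subset _ _)
      (Finset.disjoint_of_subset_right (Finset.erase_subset _ _) (X.disj a b hab))

/-- `X` respects the budgets: `|X_a| ≤ n_a` for all `a`. -/
def Feasible (n : Fin k → ℕ) (X : KTuple k V) : Prop :=
  ∀ a, (X.part a).card ≤ n a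

/-- `X` is an optimum solution for the budgets `n`. -/
def IsOptimal (f : KTuple k V → ℝ) (n : Fin k → ℕ) (X : KTuple k V) : Prop :=
  Feasible n X ∧ ∀ Y, Feasible n Y → f Y ≤ f X

end KTuple

/-- `f` is `k`-submodular. -/
def KSubmodular {k : ℕ} {V : Type*} [DecidableEq V] (f : KTuple k V → ℝ) : Prop :=
  ∀ X Y : KTuple k V, f (X.meet Y) + f (X.join Y) ≤ f X + f Y

/-- The marginal gain `Δ_{t,a} f(X)`. -/
def marginal {k : ℕ} {V : Type*} [DecidableEq V] (f : KTuple k V → ℝ)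
    (X : KTuple k V) (t : V) (a : Fin k) : ℝ :=
  f (X.assign t a) - f X

noncomputable section

/-! ### Thresholds -/

/-- `c = (1 + d) / ((1 + d/n)^n - 1)`. -/
def coeffC (d : ℝ) (n : ℕ) : ℝ :=
  (1 + d) / ((1 + d / n) ^ n - 1)

/-- `g(i) = (c/n) (1 + d/n)^(i-1)`, for `1 ≤ i ≤ n`. -/
def coeffG (d : ℝ) (n i : ℕ) : ℝ :=
  coeffC d n / n * (1 + d / n) ^ (i - 1)

/-- The `i`-th largest (`i ≥ 1`) of the weights `w t`, `t ∈ S` (counted with repetitions), and `0`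
if `i > |S|`. -/
def nthLargest {V : Type*} (S : Finset V) (w : V → ℝ) (i : ℕ) : ℝ :=
  ((S.val.map w).sort (· ≥ ·)).getD (i - 1) 0

/-- The threshold `β = ∑_{i=1}^n w(i) g(i)`, where `w(i)` is the `i`-th largest weight in `S`. -/
def threshold {V : Type*} (d : ℝ) (n : ℕ) (S : Finset V) (w : V → ℝ) : ℝ :=
  ∑ i ∈ Finset.Icc 1 n, nthLargest S w i * coeffG d n i

/-- A rule (with arbitrary tie-breaking, possibly depending on the arriving item) for choosing an
index of largest value. -/
def IsArgMaxRule {V ι : Type*} (r : V → (ι → ℝ) → ι) : Prop :=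
  ∀ (t : V) (x : ι → ℝ) (b : ι), x b ≤ x (r t x)

/-- A rule (with arbitrary tie-breaking, possibly depending on the arriving item) for choosing an
item of least weight in a nonempty set of items. -/
def IsArgMinRule {V : Type*} (r : V → Finset V → (V → ℝ) → V) : Prop :=
  ∀ (t : V) (S : Finset V) (w : V → ℝ), S.Nonempty → r t S w ∈ S ∧ ∀ i ∈ S, w (r t S w) ≤ w i

/-! ### The threshold algorithm for general `k`-submodular functions -/

/-- Current solution, recorded weights `w_{t,a}`, and thresholds `β_a`. -/
structure KState (k : ℕ) (V : Type*) where
  sol : KTuple k V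
  weight : V → Fin k → ℝ
  beta : Fin k → ℝ

section KAlg

variable {k : ℕ} {V : Type*} [DecidableEq V]

/-- The modified discounted gain `Δ_{t,a} f(S) - β_a - min_{a' ≠ a} β_{a'}`. -/
def modGain (f : KTuple k V → ℝ) (s : KState k V) (t : V) (a : Fin k) : ℝ :=
  marginal f s.sol t a - s.beta a - ⨅ b : {b : Fin k // b ≠ a}, s.beta b

/-- The iteration of the algorithm in which item `t` arrives. -/
def kStep (f : KTuple k V → ℝ) (n : Fin k → ℕ) (d : Fin k → ℝ)
    (amax : V → (Fin k → ℝ) → Fin k) (amin : V → Finset V → (V → ℝ) → V)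
    (s : KState k V) (t : V) : KState k V :=
  let w : V → Fin k → ℝ := Function.update s.weight t (fun a => marginal f s.sol t a)
  let a : Fin k := amax t (modGain f s t)
  if 0 ≤ w t a - s.beta a then
    let S : KTuple k V :=
      if (s.sol.part a).card < n a then s.sol.assign t a
      else (s.sol.remove (amin t (s.sol.part a) (fun i => w i a))).assign t a
    { sol := S
      weight := w
      beta := Function.update s.beta a (threshold (d a) (n a) (S.part a) (fun i => w i a)) }
  else { s with weight := w }

/-- The solution returned on the stream `order`. -/
def kAlg (f : KTuple k V → ℝ) (n : Fin k → ℕ) (d : Fin k → ℝ)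
    (amax : V → (Fin k → ℝ) → Fin k) (amin : V → Finset V → (V → ℝ) → V)
    (order : List V) : KTuple k V :=
  (order.foldl (kStep f n d amax amin)
    { sol := KTuple.empty k V, weight := fun _ _ => 0, beta := fun _ => 0 }).sol

end KAlg

/-- Parameters `d_a` of the `k`-submodular algorithm, as a function of the budget `n_a ≥ 1`. -/
def dMon (n : ℕ) : ℝ :=
  if n = 1 then 1 else if n = 2 then 1.0642 else if n = 3 then 1.0893 else 1.1461

/-- `Q_a = (1 + d_a) (1 + 1 / ((1 + d_a/n_a)^{n_a} - 1))`. -/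
def QMon (n : ℕ) : ℝ :=
  (1 + dMon n) * (1 + 1 / ((1 + dMon n / n) ^ n - 1))

/-- `α_mon = min_a 1/Q_a`. -/
def alphaMon {k : ℕ} (n : Fin k → ℕ) : ℝ :=
  ⨅ a, 1 / QMon (n a)

/-! ### The subsampled threshold algorithm for submodular functions and partition matroids -/

/-- Current solution, recorded weights `w_t`, and thresholds `β_a`. -/
structure PState (k : ℕ) (V : Type*) where
  sol : Finset V
  weight : V → ℝ
  beta : Fin k → ℝ

section PAlg

variable {k : ℕ} {V : Type*} [DecidableEq V]

/-- The iteration in which item `t` arrives; `Z t` is the coin flipped for `t`, and `P t` is the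
part of the partition that `t` belongs to. -/
def pStep (g : Finset V → ℝ) (P : V → Fin k) (n : Fin k → ℕ) (d : Fin k → ℝ)
    (amin : V → Finset V → (V → ℝ) → V) (Z : V → Bool)
    (s : PState k V) (t : V) : PState k V :=
  let a : Fin k := P t
  let w : V → ℝ := Function.update s.weight t (g (insert t s.sol) - g s.sol)
  if 0 ≤ w t - s.beta a ∧ Z t = true then
    let Sa : Finset V := s.sol.filter (fun i => P i = a)
    let S : Finset V :=
      if Sa.card < n a then insert t s.sol
      else insert t (s.sol.erase (amin t Sa w))
    { sol := S
      weight := w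
      beta := Function.update s.beta a
        (threshold (d a) (n a) (S.filter (fun i => P i = a)) w) }
  else { s with weight := w }

/-- The solution returned on the stream `order`, when the coins show `Z`. -/
def pAlg (g : Finset V → ℝ) (P : V → Fin k) (n : Fin k → ℕ) (d : Fin k → ℝ)
    (amin : V → Finset V → (V → ℝ) → V) (Z : V → Bool) (order : List V) : Finset V :=
  (order.foldl (pStep g P n d amin Z)
    { sol := ∅, weight := fun _ => 0, beta := fun _ => 0 }).sol

end PAlg

/-- The sampling probability `p`. -/
def pNmp {k : ℕ} (n : Fin k → ℕ) : ℝ :=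
  open Classical in if ∃ a, n a ≤ 10 then 0.3 else 1 / (1.9532 + 1)

/-- The values of `d_a` when some budget is at most `10`; here `7/3 = (1 - p)/p` for `p = 0.3`. -/
def dNmpSmall (n : ℕ) : ℝ :=
  if n = 1 then 1
  else if n = 2 then 1.7961
  else if n = 3 then 2.0654
  else if n = 4 then 2.1627
  else if n = 5 then 2.2107
  else if n = 6 then 2.2387
  else if n = 7 then 2.2567
  else if n = 8 then 2.2692
  else if n = 9 then 2.2783
  else if n = 10 then 2.2852
  else 7 / 3

/-- The parameters `d_a`. -/
def dNmp {k : ℕ} (n : Fin k → ℕ) (a : Fin k) : ℝ :=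
  open Classical in if ∃ b, n b ≤ 10 then dNmpSmall (n a) else 1.9532

/-- `Q_a = max {1 + c_a + d_a, (1 - 1/n_a) c_a + 1/p}`. -/
def QNmp {k : ℕ} (n : Fin k → ℕ) (a : Fin k) : ℝ :=
  max (1 + coeffC (dNmp n a) (n a) + dNmp n a)
    ((1 - 1 / (n a : ℝ)) * coeffC (dNmp n a) (n a) + 1 / pNmp n)

/-- `α_nmp = min_a (1 - p)/Q_a`. -/
def alphaNmp {k : ℕ} (n : Fin k → ℕ) : ℝ :=
  ⨅ a, (1 - pNmp n) / QNmp n a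

/-! ### The algorithm for arbitrary budgets -/

section AnyBudget

variable {k : ℕ} {V : Type*} [DecidableEq V]

/-- A cardinality constraint as a partition matroid with one part: its budget vector. -/
def cardBudget (m : ℕ) : Fin 1 → ℕ := fun _ => m

/-- Lower the budget of part `a₀` to the sum of the other budgets (it is left alone if it does not
exceed that sum). -/
def reducedBudget (n : Fin k → ℕ) (a₀ : Fin k) : Fin k → ℕ :=
  Function.update n a₀ (min (n a₀) (∑ a ∈ Finset.univ.erase a₀, n a))

/-- First solution: maximize `g(S) = f(∅, …, S, …, ∅)` subject to `|S| ≤ n_{a₀}` with the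
subsampled algorithm, and allocate the result to part `a₀`. -/
def solA (f : KTuple k V → ℝ) (n : Fin k → ℕ) (a₀ : Fin k)
    (amin : V → Finset V → (V → ℝ) → V) (order : List V) (Z : V → Bool) : KTuple k V :=
  KTuple.single a₀
    (pAlg (fun S => f (KTuple.single a₀ S)) (fun _ => (0 : Fin 1))
      (cardBudget (n a₀)) (dNmp (cardBudget (n a₀))) amin Z order)

/-- Second solution: the `k`-submodular algorithm with the reduced budgets. -/
def solB (f : KTuple k V → ℝ) (n : Fin k → ℕ) (a₀ : Fin k)
    (amax : V → (Fin k → ℝ) → Fin k) (amin : V → Finset V → (V → ℝ) → V)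
    (order : List V) : KTuple k V :=
  kAlg f (reducedBudget n a₀) (fun a => dMon (reducedBudget n a₀ a)) amax amin order

/-- The sampling probability used for the first solution. -/
def probA (n : Fin k → ℕ) (a₀ : Fin k) : ℝ := pNmp (cardBudget (n a₀))

/-- `α_nmp` for the first solution. -/
def alphaA (n : Fin k → ℕ) (a₀ : Fin k) : ℝ := alphaNmp (cardBudget (n a₀))

/-- `α_mon` for the second solution. -/
def alphaB (n : Fin k → ℕ) (a₀ : Fin k) : ℝ := alphaMon (reducedBudget n a₀)

/-- The probability `q` with which the online variant constructs the first solution. -/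
def probChooseA (n : Fin k → ℕ) (a₀ : Fin k) : ℝ :=
  (1 / alphaA n a₀) / (1 / alphaA n a₀ + 2 / alphaB n a₀)

end AnyBudget

end

/-! Splitting the optimum. The optimum is the join of its part `a₀` alone and of the tuple with part
`a₀` cleared; since `f ≥ 0` at the meet, its value is at most the sum of the two
(`KSubmodular.le_single_add_clear`). The first piece is a candidate for maximizing the submodular
function `g` under a cardinality constraint, which is the task of solution A. The second fits the
reduced budgets, none of which exceeds the sum of the others; this balance is what solution B needs.
Hence f(S*) ≤ E f(A) / α_nmp + 2 f(B) / α_mon. Normalizing the two coefficients gives q and 1 - q,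
and the maximum dominates this mixture.

Thresholds. The coefficients of β are geometric with ratio 1 + d/n, and c is tuned so that accepting
weight w and disposing of weight m gives n(β' - β) ≤ c(w - m) + dβ - (1 + d)m
(`acceptEffect_replaceMin`). Both analyses compare a potential containing nβ with Q times the
recorded weight of the current solution. That weight is a lower bound for the gain in value, because
each weight was measured against a solution containing all earlier items that still remain.

Solution B. Transform the comparison tuple O item by item into the tuple of all items ever accepted.
Moving an item may hurt, as `f` is not monotone; pairwise monotonicity and the choice rule bound the
loss by the charge β_b + min_{b' ≠ b} β_{b'}, for b the part of the item in O, plus terms paid by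
the accepted gain (`KSubmodular.value_sub_le`). For balanced budgets the charges total at most 2 ∑
n_a β_a (`sum_mul_minOthers_le`), which the potential supplies.

Solution A. The set of accepted items contains each item with probability at most p, so adding it to
O keeps at least (1 - p) g(O) in expectation (`one_sub_mul_le_sum_of_random`). An item of O that
reaches the threshold may be lost to its coin; a zero-mean `balance` records this loss against the
surplus of the lucky outcome, so the potential inequality holds for every outcome of the coins
(`PInvariant.step`) and the balance vanishes on averaging (`PTrace.sum_balance_run`). -/

/-! ### Weighted sums over sorted lists -/

/-- The sum `∑ i, L[i] * G i`. -/
def weightedSum : (ℕ → ℝ) → List ℝ → ℝ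
  | _, [] => 0
  | G, x :: L => x * G 0 + weightedSum (fun i => G (i + 1)) L

theorem weightedSum_eq_sum_range (L : List ℝ) (G : ℕ → ℝ) (n : ℕ) (h : L.length ≤ n) :
    ∑ i ∈ Finset.range n, L.getD i 0 * G i = weightedSum G L := by
  induction L generalizing G n with
  | nil => simp [weightedSum]
  | cons x L ih =>
    obtain ⟨n, rfl⟩ : ∃ m, n = m + 1 := ⟨n - 1, by simp at h; omega⟩
    rw [Finset.sum_range_succ', weightedSum, ← ih _ n (by simpa using h)]
    simp [add_comm]

theorem weightedSum_append_singleton (L : List ℝ) (G : ℕ → ℝ) (m : ℝ) :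
    weightedSum G (L ++ [m]) = weightedSum G L + m * G L.length := by
  induction L generalizing G with
  | nil => simp [weightedSum]
  | cons x L ih => simp [weightedSum, ih]; ring

theorem weightedSum_smul (L : List ℝ) (G : ℕ → ℝ) (r : ℝ) :
    weightedSum (fun i => r * G i) L = r * weightedSum G L := by
  induction L generalizing G with
  | nil => simp [weightedSum]
  | cons x L ih => simp only [weightedSum, ih (fun i => G (i + 1))]; ring

theorem le_weightedSum (L : List ℝ) (G : ℕ → ℝ) (m : ℝ) (hG : ∀ i, 0 ≤ G i)
    (hL : ∀ x ∈ L, m ≤ x) : m * ∑ i ∈ Finset.range L.length, G i ≤ weightedSum G L := by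
  induction L generalizing G with
  | nil => simp [weightedSum]
  | cons x L ih =>
    rw [List.length_cons, Finset.sum_range_succ', weightedSum, mul_add, add_comm]
    exact add_le_add (mul_le_mul_of_nonneg_right (hL x (by simp)) (hG 0))
      (ih _ (fun i => hG (i + 1)) fun y hy => hL y (by simp [hy]))

/-- Moving `w` to the front past larger entries puts those entries on larger coefficients
(rearrangement). At the front, `w` shifts all other entries by one index, which for geometric
coefficients is a multiplication. -/
theorem weightedSum_orderedInsert_le (L : List ℝ) (G : ℕ → ℝ) (w : ℝ) (hG : Monotone G) :
    weightedSum G (L.orderedInsert (· ≥ ·) w) ≤ weightedSum G (w :: L) := by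
  induction L generalizing G with
  | nil => simp
  | cons x L ih =>
    rw [List.orderedInsert]
    split_ifs with h
    · exact le_rfl
    · have h1 := ih (fun i => G (i + 1)) fun i j hij => hG (by omega)
      have h2 := hG (Nat.zero_le 1)
      simp only [weightedSum] at h1 ⊢
      nlinarith [mul_nonneg (sub_nonneg.2 (not_le.1 h).le) (sub_nonneg.2 h2)]

/-- In a decreasing list each entry dominates its successor, so the inequality holds entry by entry.
-/
theorem weightedSum_append_le_cons (L : List ℝ) (G : ℕ → ℝ) (x m : ℝ) (hG : ∀ i, 0 ≤ G i)
    (hL : (x :: L).Pairwise (· ≥ ·)) (hm : ∀ y ∈ x :: L, m ≤ y) :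
    weightedSum G (L ++ [m]) ≤ weightedSum G (x :: L) := by
  induction L generalizing G x with
  | nil =>
    simpa [weightedSum] using mul_le_mul_of_nonneg_right (hm x (by simp)) (hG 0)
  | cons y L ih =>
    rw [List.cons_append, weightedSum, weightedSum]
    exact add_le_add
      (mul_le_mul_of_nonneg_right (List.rel_of_pairwise_cons hL (by simp)) (hG 0))
      (ih _ y (fun i => hG (i + 1)) hL.of_cons fun z hz => hm z (List.mem_cons_of_mem _ hz))

/-- Replacing the least entry by a larger one raises every order statistic. This makes thresholds
nondecreasing over time. -/
theorem weightedSum_append_le_orderedInsert (L : List ℝ) (G : ℕ → ℝ) (w m : ℝ)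
    (hG : ∀ i, 0 ≤ G i) (hL : L.Pairwise (· ≥ ·)) (hm : ∀ y ∈ L, m ≤ y) (hw : m ≤ w) :
    weightedSum G (L ++ [m]) ≤ weightedSum G (L.orderedInsert (· ≥ ·) w) := by
  induction L generalizing G with
  | nil => simpa [weightedSum] using mul_le_mul_of_nonneg_right hw (hG 0)
  | cons x L ih =>
    rw [List.orderedInsert]
    split_ifs with h
    · refine weightedSum_append_le_cons _ G w m hG (List.pairwise_cons.2 ⟨?_, hL⟩) ?_
      · intro y hy
        rcases List.mem_cons.1 hy with rfl | hy
        · exact h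
        · exact (List.rel_of_pairwise_cons hL hy).trans h
      · intro y hy
        rcases List.mem_cons.1 hy with rfl | hy
        exacts [hw, hm y hy]
    · rw [List.cons_append, weightedSum, weightedSum]
      exact add_le_add_right (ih _ (fun i => hG (i + 1)) hL.of_cons
        fun z hz => hm z (List.mem_cons_of_mem _ hz)) _

/-! ### The coefficients -/

theorem one_lt_one_add_div_pow {d : ℝ} {n : ℕ} (hd : 0 < d) (hn : 1 ≤ n) :
    1 < (1 + d / n) ^ n := by
  have : (0 : ℝ) < n := by exact_mod_cast hn
  exact one_lt_pow₀ (by have := div_pos hd this; linarith) (by omega)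

theorem coeffC_pos {d : ℝ} {n : ℕ} (hd : 0 < d) (hn : 1 ≤ n) : 0 < coeffC d n :=
  div_pos (by linarith) (by linarith [one_lt_one_add_div_pow hd hn])

/-- The equation that defines c: it makes the coefficient of the disposed weight equal to c + 1 + d.
-/
theorem coeffC_mul_pow {d : ℝ} {n : ℕ} (hd : 0 < d) (hn : 1 ≤ n) :
    coeffC d n * (1 + d / n) ^ n = coeffC d n + 1 + d := by
  have := one_lt_one_add_div_pow hd hn
  have h : (1 + d / n) ^ n - 1 ≠ 0 := by linarith
  rw [coeffC]
  generalize (1 + d / (n : ℝ)) ^ n = E at h ⊢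
  field_simp
  ring

theorem coeffG_succ_zero (d : ℝ) (n : ℕ) : coeffG d n (0 + 1) = coeffC d n / n := by
  simp [coeffG]

theorem coeffG_succ_succ (d : ℝ) (n i : ℕ) :
    coeffG d n (i + 1 + 1) = (1 + d / n) * coeffG d n (i + 1) := by
  simp [coeffG, pow_succ]; ring

theorem coeffG_pos {d : ℝ} {n : ℕ} (hd : 0 < d) (hn : 1 ≤ n) (i : ℕ) : 0 < coeffG d n i := by
  have := coeffC_pos hd hn
  have : (0 : ℝ) < n := by exact_mod_cast hn
  unfold coeffG; positivity

theorem coeffG_succ_monotone {d : ℝ} {n : ℕ} (hd : 0 < d) (hn : 1 ≤ n) :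
    Monotone fun i => coeffG d n (i + 1) := by
  refine monotone_nat_of_le_succ fun i => ?_
  have : (0 : ℝ) < n := by exact_mod_cast hn
  have h := mul_pos (div_pos hd this) (coeffG_pos hd hn (i + 1))
  rw [coeffG_succ_succ]
  linarith

theorem sum_coeffG {d : ℝ} {n : ℕ} (hd : 0 < d) (hn : 1 ≤ n) :
    ∑ i ∈ Finset.range n, coeffG d n (i + 1) = (1 + d) / d := by
  have hn' : (0 : ℝ) < n := by exact_mod_cast hn
  have h0 := div_pos hd hn'
  have h1 := coeffC_mul_pow hd hn
  simp only [coeffG, Nat.add_sub_cancel]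
  rw [← Finset.mul_sum, geom_sum_eq (by linarith)]
  have : coeffC d n / n * (((1 + d / n) ^ n - 1) / (1 + d / n - 1))
      = (coeffC d n * (1 + d / n) ^ n - coeffC d n) / d := by
    rw [add_sub_cancel_left]; field_simp
  rw [this, h1]; ring

/-! ### Thresholds -/

/-- The weights of the items of `S` in decreasing order. -/
noncomputable def sortedWeights {V : Type*} (S : Finset V) (w : V → ℝ) : List ℝ :=
  (S.val.map w).sort (· ≥ ·)

section

variable {V : Type*}

theorem sortedWeights_pairwise (S : Finset V) (w : V → ℝ) :
    (sortedWeights S w).Pairwise (· ≥ ·) :=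
  Multiset.pairwise_sort _ _

theorem coe_sortedWeights (S : Finset V) (w : V → ℝ) :
    (sortedWeights S w : Multiset ℝ) = S.val.map w :=
  Multiset.sort_eq _ _

theorem length_sortedWeights (S : Finset V) (w : V → ℝ) : (sortedWeights S w).length = S.card := by
  simp [sortedWeights]

theorem mem_sortedWeights {S : Finset V} {w : V → ℝ} {x : ℝ} :
    x ∈ sortedWeights S w ↔ ∃ i ∈ S, w i = x := by
  simp [sortedWeights]

theorem sortedWeights_insert [DecidableEq V] {S : Finset V} {t : V} (w : V → ℝ) (ht : t ∉ S) :
    sortedWeights (insert t S) w = (sortedWeights S w).orderedInsert (· ≥ ·) (w t) := by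
  refine List.Perm.eq_of_pairwise' (r := (· ≥ ·)) (sortedWeights_pairwise _ _)
    ((sortedWeights_pairwise S w).orderedInsert _ _) ?_
  refine List.Perm.trans ?_ (List.perm_orderedInsert _ _ _).symm
  rw [← Multiset.coe_eq_coe, ← Multiset.cons_coe, coe_sortedWeights, coe_sortedWeights,
    Finset.insert_val_of_notMem ht, Multiset.map_cons]

theorem sortedWeights_eq_append [DecidableEq V] {S : Finset V} {i : V} (w : V → ℝ) (hi : i ∈ S)
    (hmin : ∀ j ∈ S, w i ≤ w j) :
    sortedWeights S w = sortedWeights (S.erase i) w ++ [w i] := by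
  refine List.Perm.eq_of_pairwise' (r := (· ≥ ·)) (sortedWeights_pairwise _ _) ?_ ?_
  · rw [List.pairwise_append]
    refine ⟨sortedWeights_pairwise _ _, by simp, ?_⟩
    intro x hx y hy
    obtain ⟨j, hj, rfl⟩ := mem_sortedWeights.1 hx
    rw [List.mem_singleton.1 hy]
    exact hmin j (Finset.mem_of_mem_erase hj)
  · rw [← Multiset.coe_eq_coe, ← Multiset.coe_add, coe_sortedWeights, coe_sortedWeights]
    conv_lhs => rw [← Finset.insert_erase hi,
      Finset.insert_val_of_notMem (Finset.notMem_erase i S), Multiset.map_cons]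
    rw [← Multiset.singleton_add, add_comm]; rfl

theorem threshold_eq_weightedSum (d : ℝ) {n : ℕ} {S : Finset V} (w : V → ℝ) (h : S.card ≤ n) :
    threshold d n S w = weightedSum (fun i => coeffG d n (i + 1)) (sortedWeights S w) := by
  rw [← weightedSum_eq_sum_range _ _ n (by rwa [length_sortedWeights]), threshold,
    Finset.range_eq_Ico]
  exact (Finset.sum_Ico_add' (fun i => (sortedWeights S w).getD (i - 1) 0 *
      coeffG d n i) 0 n 1).symm

theorem threshold_congr (d : ℝ) (n : ℕ) {S : Finset V} {w w' : V → ℝ} (h : ∀ i ∈ S, w i = w' i) :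
    threshold d n S w = threshold d n S w' := by
  have : S.val.map w = S.val.map w' := Multiset.map_congr rfl fun i hi => h i hi
  simp [threshold, nthLargest, this]

theorem threshold_empty (d : ℝ) (n : ℕ) (w : V → ℝ) : threshold d n ∅ w = 0 := by
  rw [threshold_eq_weightedSum d w (by simp)]
  simp [sortedWeights, weightedSum]

theorem threshold_nonneg {d : ℝ} {n : ℕ} (hd : 0 < d) (hn : 1 ≤ n) {S : Finset V} {w : V → ℝ}
    (hS : S.card ≤ n) (hw : ∀ i ∈ S, 0 ≤ w i) : 0 ≤ threshold d n S w := by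
  rw [threshold_eq_weightedSum d w hS]
  refine le_trans (by simp) (le_weightedSum _ _ 0 (fun i => (coeffG_pos hd hn _).le) ?_)
  intro x hx
  obtain ⟨i, hi, rfl⟩ := mem_sortedWeights.1 hx
  exact hw i hi

variable [DecidableEq V]

/-- Add `t` to `S`, after the removal of `i` if `S` has `n` items. -/
def replaceMin (n : ℕ) (S : Finset V) (i t : V) : Finset V :=
  if S.card < n then insert t S else insert t (S.erase i)

/-- The weight that is lost by the disposal. -/
noncomputable def disposedWeight (n : ℕ) (S : Finset V) (w : V → ℝ) (i : V) : ℝ :=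
  if S.card < n then 0 else w i

/-- The effect of the acceptance of an item on one part of the solution. -/
structure AcceptEffect (d : ℝ) (n : ℕ) (S S' : Finset V) (w : V → ℝ) (t : V) (m : ℝ) : Prop where
  card_le : S'.card ≤ n
  disposed_nonneg : 0 ≤ m
  disposed_le : m ≤ threshold d n S w
  threshold_le : threshold d n S w ≤ threshold d n S' w
  sum_eq : ∑ i ∈ S', w i = ∑ i ∈ S, w i + (w t - m)
  increase_le : n * (threshold d n S' w - threshold d n S w)
    ≤ coeffC d n * (w t - m) + d * threshold d n S w - (1 + d) * m

/-- The new threshold is at most (c/n)w + (1 + d/n)(β - m G(n-1)): the new weight goes to the front,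
the survivors move one place down, and the disposed weight leaves the last place. -/
theorem acceptEffect_replaceMin {d : ℝ} {n : ℕ} (hd : 0 < d) (hn : 1 ≤ n) {S : Finset V}
    {w : V → ℝ} (hS : S.card ≤ n) (hw : ∀ i ∈ S, 0 ≤ w i) {t : V} (ht : t ∉ S)
    (hwt : threshold d n S w ≤ w t) {i : V} (hi : S.Nonempty → i ∈ S ∧ ∀ j ∈ S, w i ≤ w j) :
    AcceptEffect d n S (replaceMin n S i t) w t (disposedWeight n S w i) := by
  have hn' : (0 : ℝ) < n := by exact_mod_cast hn
  set G : ℕ → ℝ := fun i => coeffG d n (i + 1) with hG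
  have hGpos : ∀ i, 0 ≤ G i := fun i => (coeffG_pos hd hn _).le
  have hGmono : Monotone G := coeffG_succ_monotone hd hn
  -- Both cases at once: `S₀` is the set of survivors and `m` the disposed weight. If there is room,
  -- m = 0, and appending a zero weight does not change the threshold.
  obtain ⟨S₀, m, hS₀, hcard, hS', hm, hm0, hsum, hβ, hmβ, hle⟩ : ∃ (S₀ : Finset V) (m : ℝ),
      S₀ ⊆ S ∧ S₀.card < n ∧ replaceMin n S i t = insert t S₀ ∧ disposedWeight n S w i = m ∧
      0 ≤ m ∧ ∑ i ∈ S, w i = ∑ i ∈ S₀, w i + m ∧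
      (threshold d n S w = weightedSum G (sortedWeights S₀ w) + m * G (n - 1) ∧
        threshold d n S w ≤ weightedSum G (sortedWeights S₀ w ++ [m])) ∧
      m ≤ threshold d n S w ∧ ∀ j ∈ S₀, m ≤ w j := by
    by_cases h : S.card < n
    · refine ⟨S, 0, subset_rfl, h, by simp [replaceMin, h], by simp [disposedWeight, h], le_rfl,
        by simp, ⟨?_, ?_⟩, threshold_nonneg hd hn hS hw, hw⟩
      · rw [threshold_eq_weightedSum d w hS]; simp [hG]
      · rw [threshold_eq_weightedSum d w hS, weightedSum_append_singleton]; simp [hG]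
    · have hne : S.Nonempty := by rw [← Finset.card_pos]; omega
      obtain ⟨his, hmin⟩ := hi hne
      have hlen : (sortedWeights (S.erase i) w).length = n - 1 := by
        rw [length_sortedWeights, Finset.card_erase_of_mem his]; omega
      have hthr : threshold d n S w = weightedSum G (sortedWeights (S.erase i) w ++ [w i]) := by
        rw [threshold_eq_weightedSum d w hS, sortedWeights_eq_append w his hmin]
      refine ⟨S.erase i, w i, Finset.erase_subset _ _, ?_, by simp [replaceMin, h],
        by simp [disposedWeight, h], hw i his, ?_, ⟨?_, hthr.le⟩, ?_,
        fun j hj => hmin j (Finset.mem_of_mem_erase hj)⟩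
      · rw [Finset.card_erase_of_mem his]; omega
      · rw [Finset.sum_erase_add _ _ his]
      · rw [hthr, weightedSum_append_singleton, hlen]
      · rw [threshold_eq_weightedSum d w hS]
        have h1 : (sortedWeights S w).length = n := by rw [length_sortedWeights]; omega
        -- All n weights are at least `w i`, and the coefficients sum to (1 + d)/d ≥ 1.
        refine le_trans ?_ (le_weightedSum _ _ (w i) hGpos ?_)
        · rw [h1, sum_coeffG hd hn]
          refine le_mul_of_one_le_right (hw i his) ?_
          rw [le_div_iff₀ hd]; linarith
        · intro x hx
          obtain ⟨j, hj, rfl⟩ := mem_sortedWeights.1 hx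
          exact hmin j hj
  have htS₀ : t ∉ S₀ := fun h => ht (hS₀ h)
  have hcard' : (insert t S₀).card ≤ n := by rw [Finset.card_insert_of_notMem htS₀]; omega
  rw [hS', hm]
  have hnew := threshold_eq_weightedSum d w hcard'
  rw [sortedWeights_insert w htS₀] at hnew
  refine ⟨hcard', hm0, hmβ, ?_, ?_, ?_⟩
  · rw [hnew]
    refine hβ.2.trans (weightedSum_append_le_orderedInsert _ _ _ _ hGpos
      (sortedWeights_pairwise _ _) ?_ (hmβ.trans hwt))
    intro x hx
    obtain ⟨j, hj, rfl⟩ := mem_sortedWeights.1 hx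
    exact hle j hj
  · rw [Finset.sum_insert htS₀, hsum]; ring
  · have h1 := weightedSum_orderedInsert_le (sortedWeights S₀ w) G (w t) hGmono
    rw [← hnew, weightedSum] at h1
    have h2 : (fun i => G (i + 1)) = fun i => (1 + d / n) * G i := by
      funext i; exact coeffG_succ_succ d n i
    rw [h2, weightedSum_smul, show G 0 = coeffC d n / n from coeffG_succ_zero d n,
      eq_sub_of_add_eq hβ.1.symm] at h1
    have h3 : n * ((1 + d / n) * G (n - 1)) = coeffC d n + 1 + d := by
      have : G (n - 1) = coeffC d n / n * (1 + d / n) ^ (n - 1) := by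
        simp [hG, coeffG]
      rw [this, ← coeffC_mul_pow hd hn]
      have h6 : (1 + d / (n : ℝ)) ^ n = (1 + d / n) ^ (n - 1) * (1 + d / n) := by
        rw [← pow_succ, Nat.sub_add_cancel hn]
      rw [h6]; field_simp
    have h4 := mul_le_mul_of_nonneg_left h1 hn'.le
    have h5 : (n : ℝ) * (w t * (coeffC d n / n) + (1 + d / n) * (threshold d n S w - m * G (n - 1)))
        = w t * coeffC d n + (n + d) * threshold d n S w - m * (n * ((1 + d / n) * G (n - 1))) := by
      field_simp
      ring
    rw [h5, h3] at h4
    linarith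

end

/-! ### `k`-submodular functions -/

section

theorem KTuple.eq_of_mem_part {k : ℕ} {V : Type*} {X : KTuple k V} {t : V} {a b : Fin k} (ha : t ∈ X.part a)
    (hb : t ∈ X.part b) : a = b := by
  by_contra h
  exact Finset.disjoint_left.1 (X.disj a b h) ha hb

variable {k : ℕ} {V : Type*} [DecidableEq V]

theorem KTuple.part_assign_self (X : KTuple k V) (t : V) (a : Fin k) :
    (X.assign t a).part a = insert t (X.part a) := by
  simp [KTuple.assign]

theorem KTuple.part_assign_of_ne (X : KTuple k V) (t : V) {a b : Fin k} (h : b ≠ a) :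
    (X.assign t a).part b = (X.part b).erase t := by
  simp [KTuple.assign, h]

theorem KTuple.part_remove (X : KTuple k V) (t : V) (a : Fin k) :
    (X.remove t).part a = (X.part a).erase t := rfl

theorem KTuple.remove_eq_self {X : KTuple k V} {t : V} (h : ∀ b, t ∉ X.part b) :
    X.remove t = X := by
  ext a x
  simp only [KTuple.part_remove, Finset.mem_erase]
  exact ⟨fun hx => hx.2, fun hx => ⟨fun hxt => h a (hxt ▸ hx), hx⟩⟩

theorem KTuple.assign_remove (X : KTuple k V) (t : V) (a : Fin k) :
    (X.remove t).assign t a = X.assign t a := by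
  ext b x
  simp only [KTuple.assign, KTuple.part_remove]
  split_ifs
  · simp only [Finset.mem_insert, Finset.mem_erase]; tauto
  · simp

theorem KTuple.assign_eq_self {X : KTuple k V} {t : V} {a : Fin k} (h : t ∈ X.part a) :
    X.assign t a = X := by
  ext b x
  by_cases hb : b = a
  · subst hb; simp only [KTuple.part_assign_self, Finset.mem_insert]
    exact ⟨fun hx => hx.elim (fun hx => hx ▸ h) id, Or.inr⟩
  · simp only [KTuple.part_assign_of_ne X t hb, Finset.mem_erase]
    refine ⟨fun hx => hx.2, fun hx => ⟨fun hxt => hb (KTuple.eq_of_mem_part (hxt ▸ hx) h), hx⟩⟩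

theorem KTuple.mem_part_join {X Y : KTuple k V} {a : Fin k} {x : V} :
    x ∈ (X.join Y).part a ↔ (x ∈ X.part a ∨ x ∈ Y.part a) ∧
      ∀ b, b ≠ a → x ∉ X.part b ∧ x ∉ Y.part b := by
  simp [KTuple.join]

theorem KTuple.mem_part_meet {X Y : KTuple k V} {a : Fin k} {x : V} :
    x ∈ (X.meet Y).part a ↔ x ∈ X.part a ∧ x ∈ Y.part a := by
  simp [KTuple.meet]

theorem KTuple.mem_part_assign {X : KTuple k V} {t : V} {a b : Fin k} {x : V}
    (ht : ∀ c, t ∉ X.part c) :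
    x ∈ (X.assign t a).part b ↔ x ∈ X.part b ∨ (b = a ∧ x = t) := by
  by_cases hb : b = a
  · subst hb; simp [KTuple.part_assign_self, or_comm]
  · rw [KTuple.part_assign_of_ne X t hb, Finset.mem_erase]
    simp only [hb, false_and, or_false]
    exact ⟨fun hx => hx.2, fun hx => ⟨fun hxt => ht b (hxt ▸ hx), hx⟩⟩

variable {f : KTuple k V → ℝ}

/-- Orthant submodularity. -/
theorem KSubmodular.marginal_anti (hf : KSubmodular f) {X Y : KTuple k V}
    (hXY : ∀ a, X.part a ⊆ Y.part a) {t : V} (ht : ∀ b, t ∉ Y.part b) (a : Fin k) :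
    marginal f Y t a ≤ marginal f X t a := by
  have htX : ∀ b, t ∉ X.part b := fun b h => ht b (hXY b h)
  have hmeet : (X.assign t a).meet Y = X := by
    ext b x
    rw [KTuple.mem_part_meet, KTuple.mem_part_assign htX]
    have := @hXY b x
    constructor
    · rintro ⟨h | ⟨rfl, rfl⟩, h2⟩
      exacts [h, absurd h2 (ht _)]
    · exact fun h => ⟨Or.inl h, this h⟩
  have hjoin : (X.assign t a).join Y = Y.assign t a := by
    ext b x
    rw [KTuple.mem_part_join, KTuple.mem_part_assign ht, KTuple.mem_part_assign htX]
    constructor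
    · rintro ⟨(h | h) | h, -⟩
      exacts [Or.inl (hXY b h), Or.inr h, Or.inl h]
    · rintro (h | ⟨rfl, rfl⟩)
      · refine ⟨Or.inr h, fun c hc => ?_⟩
        rw [KTuple.mem_part_assign htX]
        have hY : x ∉ Y.part c := fun h' => hc (KTuple.eq_of_mem_part h' h)
        refine ⟨?_, hY⟩
        rintro (h' | ⟨rfl, rfl⟩)
        exacts [hY (hXY c h'), ht b h]
      · refine ⟨Or.inl (Or.inr ⟨rfl, rfl⟩), fun c hc => ⟨?_, ht c⟩⟩
        rw [KTuple.mem_part_assign htX]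
        rintro (h' | ⟨rfl, -⟩)
        exacts [htX c h', hc rfl]
  have := hf (X.assign t a) Y
  rw [hmeet, hjoin] at this
  unfold marginal
  linarith

/-- Pairwise monotonicity. -/
theorem KSubmodular.marginal_add_marginal_nonneg (hf : KSubmodular f) {X : KTuple k V} {t : V}
    (ht : ∀ b, t ∉ X.part b) {a b : Fin k} (hab : a ≠ b) :
    0 ≤ marginal f X t a + marginal f X t b := by
  -- Meet and join are both `X`: an item claimed by two different parts is dropped by the join.
  have hmeet : (X.assign t a).meet (X.assign t b) = X := by
    ext c x
    rw [KTuple.mem_part_meet, KTuple.mem_part_assign ht, KTuple.mem_part_assign ht]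
    constructor
    · rintro ⟨h | ⟨rfl, rfl⟩, h' | ⟨rfl, -⟩⟩
      exacts [h, h, h', absurd rfl hab]
    · exact fun h => ⟨Or.inl h, Or.inl h⟩
  have hjoin : (X.assign t a).join (X.assign t b) = X := by
    ext c x
    rw [KTuple.mem_part_join]
    simp only [KTuple.mem_part_assign ht]
    constructor
    · rintro ⟨(h | ⟨rfl, rfl⟩) | (h | ⟨rfl, rfl⟩), h'⟩
      · exact h
      · exact absurd (Or.inr ⟨rfl, rfl⟩) (h' b hab.symm).2
      · exact h
      · exact absurd (Or.inr ⟨rfl, rfl⟩) (h' a hab).1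
    · intro h
      refine ⟨Or.inl (Or.inl h), fun e he => ?_⟩
      have h1 : x ∉ X.part e := fun h' => he (KTuple.eq_of_mem_part h' h)
      have h2 : x ≠ t := fun h' => ht c (h' ▸ h)
      simp [h1, h2]
  have := hf (X.assign t a) (X.assign t b)
  rw [hmeet, hjoin] at this
  unfold marginal
  linarith

theorem KTuple.single_assign {a : Fin k} {S : Finset V} (t : V) :
    (KTuple.single a S).assign t a = KTuple.single a (insert t S) := by
  ext b x
  by_cases hb : b = a
  · subst hb; simp [KTuple.part_assign_self, KTuple.single]
  · simp [KTuple.part_assign_of_ne _ t hb, KTuple.single, hb]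

theorem KSubmodular.single_marginal_anti (hf : KSubmodular f) (a : Fin k) {S T : Finset V}
    (hST : S ⊆ T) {t : V} (ht : t ∉ T) :
    f (KTuple.single a (insert t T)) - f (KTuple.single a T)
      ≤ f (KTuple.single a (insert t S)) - f (KTuple.single a S) := by
  have := hf.marginal_anti (X := KTuple.single a S) (Y := KTuple.single a T) (t := t)
    (fun b => by by_cases hb : b = a <;> simp [KTuple.single, hb, hST])
    (fun b => by by_cases hb : b = a <;> simp [KTuple.single, hb, ht]) a
  simpa only [marginal, KTuple.single_assign] using this

/-- The tuple with part `a` emptied. -/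
def KTuple.clear (X : KTuple k V) (a : Fin k) : KTuple k V where
  part := fun b => if b = a then ∅ else X.part b
  disj := by
    intro b c hbc
    by_cases hb : b = a
    · simp [hb]
    · by_cases hc : c = a
      · simp [hc]
      · simpa [hb, hc] using X.disj b c hbc

/-- The two tuples have join `X`; the value at their meet is dropped by nonnegativity. -/
theorem KSubmodular.le_single_add_clear (hf : KSubmodular f) (hf0 : ∀ X, 0 ≤ f X)
    (X : KTuple k V) (a : Fin k) :
    f X ≤ f (KTuple.single a (X.part a)) + f (X.clear a) := by
  have hjoin : (KTuple.single a (X.part a)).join (X.clear a) = X := by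
    ext b x
    rw [KTuple.mem_part_join]
    simp only [KTuple.single, KTuple.clear]
    constructor
    · rintro ⟨h | h, -⟩ <;> by_cases hb : b = a <;> simp_all
    · intro h
      refine ⟨by by_cases hb : b = a <;> simp_all, fun c hc => ?_⟩
      have h1 : x ∉ X.part c := fun h' => hc (KTuple.eq_of_mem_part h' h)
      by_cases hb : c = a <;> simp_all
  have h1 := hf (KTuple.single a (X.part a)) (X.clear a)
  rw [hjoin] at h1
  linarith [hf0 ((KTuple.single a (X.part a)).meet (X.clear a))]

end

/-! ### Minimum over the other parts -/

section

variable {k : ℕ}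

/-- The minimum of `β` over the indices other than `a`. -/
noncomputable def minOthers (β : Fin k → ℝ) (a : Fin k) : ℝ :=
  ⨅ b : {b : Fin k // b ≠ a}, β b

theorem minOthers_le (β : Fin k → ℝ) {a b : Fin k} (h : b ≠ a) : minOthers β a ≤ β b :=
  ciInf_le (f := fun b : {b : Fin k // b ≠ a} => β b) (Set.finite_range _).bddBelow ⟨b, h⟩

theorem nonempty_ne (hk : 2 ≤ k) (a : Fin k) : Nonempty {b : Fin k // b ≠ a} := by
  have : Nontrivial (Fin k) := Fin.nontrivial_iff_two_le.2 hk
  obtain ⟨b, hb⟩ := exists_ne a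
  exact ⟨⟨b, hb⟩⟩

theorem exists_eq_minOthers (hk : 2 ≤ k) (β : Fin k → ℝ) (a : Fin k) :
    ∃ b, b ≠ a ∧ β b = minOthers β a := by
  have := nonempty_ne hk a
  obtain ⟨b, hb⟩ := exists_eq_ciInf_of_finite (f := fun b : {b : Fin k // b ≠ a} => β b)
  exact ⟨b, b.2, hb⟩

theorem minOthers_mono (hk : 2 ≤ k) {β β' : Fin k → ℝ} (h : ∀ a, β a ≤ β' a) (a : Fin k) :
    minOthers β a ≤ minOthers β' a := by
  obtain ⟨b, hb, hb'⟩ := exists_eq_minOthers hk β' a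
  exact (minOthers_le β hb).trans (hb' ▸ h b)

theorem minOthers_nonneg (hk : 2 ≤ k) {β : Fin k → ℝ} (h : ∀ a, 0 ≤ β a) (a : Fin k) :
    0 ≤ minOthers β a := by
  obtain ⟨b, -, hb'⟩ := exists_eq_minOthers hk β a
  exact hb' ▸ h b

/-- Only the least β_a and the second least β_b matter. The minimum over the others is β_b at a and
at most β_a elsewhere, so the difference of the sides is at least (∑_{c ≠ a} n_c - n_a)(β_b - β_a).
-/
theorem sum_mul_minOthers_le (hk : 2 ≤ k) (β : Fin k → ℝ) (n : Fin k → ℕ)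
    (hn : ∀ a, n a ≤ ∑ b ∈ Finset.univ.erase a, n b) :
    ∑ a, n a * minOthers β a ≤ ∑ a, n a * β a := by
  have : Nonempty (Fin k) := ⟨⟨0, by omega⟩⟩
  obtain ⟨a, ha⟩ := Finite.exists_min β
  obtain ⟨b, hba, hb⟩ := exists_eq_minOthers hk β a
  have h1 : ∀ c, c ≠ a → minOthers β c ≤ β a := fun c hc => minOthers_le β hc.symm
  have h2 : ∀ c, c ≠ a → β b ≤ β c := fun c hc => hb ▸ minOthers_le β hc
  rw [← Finset.add_sum_erase _ _ (Finset.mem_univ a), ← Finset.add_sum_erase _ (fun c => n c * β c)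
    (Finset.mem_univ a), ← hb]
  have h3 : ∑ c ∈ Finset.univ.erase a, n c * minOthers β c
      ≤ (∑ c ∈ Finset.univ.erase a, (n c : ℝ)) * β a := by
    rw [Finset.sum_mul]
    exact Finset.sum_le_sum fun c hc =>
      mul_le_mul_of_nonneg_left (h1 c (Finset.ne_of_mem_erase hc)) (Nat.cast_nonneg _)
  have h4 : (∑ c ∈ Finset.univ.erase a, (n c : ℝ)) * β b
      ≤ ∑ c ∈ Finset.univ.erase a, n c * β c := by
    rw [Finset.sum_mul]
    exact Finset.sum_le_sum fun c hc =>
      mul_le_mul_of_nonneg_left (h2 c (Finset.ne_of_mem_erase hc)) (Nat.cast_nonneg _)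
  have h5 : (n a : ℝ) ≤ ∑ c ∈ Finset.univ.erase a, (n c : ℝ) := by exact_mod_cast hn a
  nlinarith [mul_nonneg (sub_nonneg.2 h5) (sub_nonneg.2 (ha b))]

theorem sum_eq_sum_add_of_eq_of_ne {φ ψ : Fin k → ℝ} {a : Fin k} {δ : ℝ} (ha : φ a = ψ a + δ)
    (h : ∀ b, b ≠ a → φ b = ψ b) : ∑ b, φ b = ∑ b, ψ b + δ := by
  rw [← Finset.add_sum_erase _ φ (Finset.mem_univ a),
    ← Finset.add_sum_erase _ ψ (Finset.mem_univ a), ha,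
    Finset.sum_congr rfl fun b hb => h b (Finset.ne_of_mem_erase hb)]
  ring

end

/-! ### Analysis of the algorithm for `k`-submodular functions -/

section

variable {k : ℕ} {V : Type*} [DecidableEq V]

/-- The number of items of part `b` of `O` among the items `T`. -/
def KTuple.seenCard (O : KTuple k V) (T : Finset V) (b : Fin k) : ℕ :=
  ((O.part b).filter (· ∈ T)).card

theorem KTuple.sum_seenCard_insert (O : KTuple k V) {T : Finset V} {t : V} (ht : t ∉ T)
    (x : Fin k → ℝ) :
    ∑ b, O.seenCard (insert t T) b * x b
      = ∑ b, O.seenCard T b * x b + ∑ b, if t ∈ O.part b then x b else 0 := by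
  rw [← Finset.sum_add_distrib]
  refine Finset.sum_congr rfl fun b _ => ?_
  split_ifs with h
  · have : (O.part b).filter (· ∈ insert t T) = insert t ((O.part b).filter (· ∈ T)) := by
      ext y; simp only [Finset.mem_filter, Finset.mem_insert]; grind
    rw [KTuple.seenCard, this, Finset.card_insert_of_notMem (by simp [ht]), KTuple.seenCard]
    push_cast; ring
  · have : (O.part b).filter (· ∈ insert t T) = (O.part b).filter (· ∈ T) := by
      ext y; simp only [Finset.mem_filter, Finset.mem_insert]; grind
    rw [KTuple.seenCard, this, KTuple.seenCard, add_zero]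

/-- The loss of value when item `t` of the tuple `U` is moved to part `a` or removed. -/
theorem KSubmodular.value_sub_le {f : KTuple k V → ℝ} (hk : 2 ≤ k) (hf : KSubmodular f)
    {s : KState k V} {t : V} {a : Fin k} (hβ : ∀ b, 0 ≤ s.beta b)
    (ha : ∀ b, modGain f s t b ≤ modGain f s t a) {U : KTuple k V}
    (hU : ∀ b, s.sol.part b ⊆ U.part b) (ht : ∀ b, t ∉ s.sol.part b) :
    (s.beta a ≤ marginal f s.sol t a → f U - f (U.assign t a) ≤
      (∑ b, if t ∈ U.part b then s.beta b + minOthers s.beta b else 0)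
        + (2 * marginal f s.sol t a - s.beta a)) ∧
    (marginal f s.sol t a < s.beta a → f U - f (U.remove t) ≤
      ∑ b, if t ∈ U.part b then s.beta b + minOthers s.beta b else 0) := by
  set R := U.remove t with hR
  have htR : ∀ b, t ∉ R.part b := fun b => by simp [hR, KTuple.part_remove]
  have hsR : ∀ b, s.sol.part b ⊆ R.part b := fun b x hx => by
    rw [hR, KTuple.part_remove, Finset.mem_erase]
    exact ⟨fun h => ht b (h ▸ hx), hU b hx⟩
  have h1 : ∀ b, marginal f R t b ≤ marginal f s.sol t b := fun b => hf.marginal_anti hsR htR b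
  have h2 : ∀ b, marginal f s.sol t b ≤ s.beta b + minOthers s.beta b +
      (marginal f s.sol t a - s.beta a - minOthers s.beta a) := by
    intro b
    have := ha b
    simp only [modGain] at this
    unfold minOthers
    linarith
  have h3 : ∀ b, 0 ≤ minOthers s.beta b := minOthers_nonneg hk hβ
  -- Take the part b ≠ a of least threshold. The loss at a is at most the gain at b, and the choice
  -- rule bounds the latter by the gain at a, since β_b cancels `minOthers` at a and `minOthers` at
  -- b is at most β_a.
  have h4 : -marginal f R t a ≤ marginal f s.sol t a := by
    obtain ⟨b, hba, hb⟩ := exists_eq_minOthers hk s.beta a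
    have := hf.marginal_add_marginal_nonneg htR hba
    linarith [h1 b, h2 b, minOthers_le s.beta hba.symm]
  have hUa : U.assign t a = R.assign t a := (KTuple.assign_remove U t a).symm
  have hRa : f (R.assign t a) = f R + marginal f R t a := by unfold marginal; ring
  by_cases h : ∃ b, t ∈ U.part b
  · obtain ⟨b, hb⟩ := h
    have hsum : (∑ c, if t ∈ U.part c then s.beta c + minOthers s.beta c else 0)
        = s.beta b + minOthers s.beta b := by
      rw [Finset.sum_eq_single b, if_pos hb]
      · intro c _ hc
        rw [if_neg fun h => hc (KTuple.eq_of_mem_part h hb)]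
      · simp
    have hUb : f U = f R + marginal f R t b := by
      have : U = R.assign t b := by rw [hR, KTuple.assign_remove, KTuple.assign_eq_self hb]
      conv_lhs => rw [this]
      unfold marginal; ring
    rw [hsum]
    refine ⟨fun hw => ?_, fun hw => ?_⟩
    · by_cases hab : b = a
      · subst hab
        rw [KTuple.assign_eq_self hb]
        linarith [hβ b, h3 b]
      · rw [hUa, hUb, hRa]
        linarith [h1 b, h2 b, h3 a]
    · rw [hUb]
      linarith [h1 b, h2 b, h3 a]
  · push Not at h
    have hUR : R = U := KTuple.remove_eq_self h
    have hsum : (∑ c, if t ∈ U.part c then s.beta c + minOthers s.beta c else 0) = 0 := by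
      simp [h]
    rw [hsum]
    refine ⟨fun hw => ?_, fun hw => by rw [hUR]; simp⟩
    rw [hUa, hRa, ← hUR]
    linarith

/-- What is maintained by the algorithm; `acc` collects the accepted items, `U` is the tuple `O`
overridden by `acc` on the items `T` seen so far. -/
structure KInvariant (f : KTuple k V → ℝ) (n : Fin k → ℕ) (d : Fin k → ℝ) (O : KTuple k V)
    (T : Finset V) (s : KState k V) (acc U : KTuple k V) : Prop where
  sol_subset : ∀ a, s.sol.part a ⊆ acc.part a
  acc_subset : ∀ a, acc.part a ⊆ U.part a
  acc_seen : ∀ a, acc.part a ⊆ T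
  seen_mem : ∀ a, ∀ t ∈ T, t ∈ U.part a → t ∈ acc.part a
  unseen_mem : ∀ a, ∀ t ∉ T, (t ∈ U.part a ↔ t ∈ O.part a)
  card_le : ∀ a, (s.sol.part a).card ≤ n a
  weight_nonneg : ∀ a, ∀ i ∈ s.sol.part a, 0 ≤ s.weight i a
  beta_eq : ∀ a, s.beta a = threshold (d a) (n a) (s.sol.part a) (fun i => s.weight i a)
  -- Quantified over all subtuples, so that it survives disposals.
  le_value : ∀ X : KTuple k V, (∀ a, X.part a ⊆ s.sol.part a) →
    f (KTuple.empty k V) + ∑ a, ∑ i ∈ X.part a, s.weight i a ≤ f X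
  -- Once all items are seen, `U` equals `acc` and the two values cancel. Charges are expressed with
  -- the current thresholds, which only grow.
  potential_le : f O - f U + f acc + 2 * ∑ a, n a * s.beta a ≤ f (KTuple.empty k V)
    + ∑ b, O.seenCard T b * (s.beta b + minOthers s.beta b)
    + 2 * ∑ a, (1 + coeffC (d a) (n a) + d a) * ∑ i ∈ s.sol.part a, s.weight i a

variable {f : KTuple k V → ℝ} {n : Fin k → ℕ} {d : Fin k → ℝ} {O : KTuple k V} {T : Finset V}

theorem KInvariant.beta_nonneg {s : KState k V} {acc U : KTuple k V} (hn : ∀ a, 1 ≤ n a)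
    (hd : ∀ a, 1 / 2 ≤ d a) (h : KInvariant f n d O T s acc U) (a : Fin k) : 0 ≤ s.beta a := by
  rw [h.beta_eq a]
  exact threshold_nonneg (by linarith [hd a]) (hn a) (h.card_le a) (h.weight_nonneg a)

theorem KInvariant.initial :
    KInvariant f n d O ∅ { sol := KTuple.empty k V, weight := fun _ _ => 0, beta := fun _ => 0 }
      (KTuple.empty k V) O where
  sol_subset := fun _ => subset_rfl
  acc_subset := fun _ => by simp [KTuple.empty]
  acc_seen := fun _ => by simp [KTuple.empty]
  seen_mem := fun _ _ h => by simp at h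
  unseen_mem := fun _ _ _ => Iff.rfl
  card_le := fun _ => by simp [KTuple.empty]
  weight_nonneg := fun _ _ h => by simp [KTuple.empty] at h
  beta_eq := fun _ => by simp [KTuple.empty, threshold_empty]
  le_value := fun X hX => by
    have : X = KTuple.empty k V := by
      ext a x
      have := hX a
      simp only [KTuple.empty, Finset.subset_empty] at this ⊢
      rw [this]
    simp [this]
  potential_le := by simp [KTuple.seenCard]

theorem KInvariant.reject (hk : 2 ≤ k) (hf : KSubmodular f) (hn : ∀ a, 1 ≤ n a)
    (hd : ∀ a, 1 / 2 ≤ d a) {s : KState k V} {acc U : KTuple k V}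
    (h : KInvariant f n d O T s acc U) {t : V} (ht : t ∉ T) {a : Fin k}
    (ha : ∀ b, modGain f s t b ≤ modGain f s t a) (hw : marginal f s.sol t a < s.beta a) :
    KInvariant f n d O (insert t T)
      { s with weight := Function.update s.weight t (fun b => marginal f s.sol t b) }
      acc (U.remove t) := by
  have htacc : ∀ b, t ∉ acc.part b := fun b hb => ht (h.acc_seen b hb)
  have htsol : ∀ b, t ∉ s.sol.part b := fun b hb => htacc b (h.sol_subset b hb)
  have hweight : ∀ b, ∀ i ∈ s.sol.part b,
      Function.update s.weight t (fun c => marginal f s.sol t c) i b = s.weight i b := by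
    intro b i hi
    rw [Function.update_of_ne fun hit : i = t => htsol b (hit ▸ hi)]
  refine ⟨h.sol_subset, ?_, ?_, ?_, ?_, h.card_le, ?_, ?_, ?_, ?_⟩
  · intro b x hx
    rw [KTuple.part_remove, Finset.mem_erase]
    exact ⟨fun hxt => htacc b (hxt ▸ hx), h.acc_subset b hx⟩
  · exact fun b => (h.acc_seen b).trans (Finset.subset_insert _ _)
  · intro b x hx hxU
    rw [KTuple.part_remove, Finset.mem_erase] at hxU
    exact h.seen_mem b x (Finset.mem_of_mem_insert_of_ne hx hxU.1) hxU.2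
  · intro b x hx
    rw [Finset.mem_insert, not_or] at hx
    rw [KTuple.part_remove, Finset.mem_erase, ← h.unseen_mem b x hx.2]
    exact ⟨fun h => h.2, fun h => ⟨hx.1, h⟩⟩
  · intro b i hi
    exact (h.weight_nonneg b i hi).trans_eq (hweight b i hi).symm
  · intro b
    rw [h.beta_eq b]
    exact threshold_congr _ _ fun i hi => (hweight b i hi).symm
  · intro X hX
    rw [Finset.sum_congr rfl fun b _ => Finset.sum_congr rfl fun i hi => hweight b i (hX b hi)]
    exact h.le_value X hX
  · have h1 := (hf.value_sub_le hk (h.beta_nonneg hn hd) ha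
      (fun b => (h.sol_subset b).trans (h.acc_subset b)) htsol).2 hw
    have h2 := O.sum_seenCard_insert ht fun b => s.beta b + minOthers s.beta b
    simp only [h.unseen_mem _ t ht] at h1
    have h3 := h.potential_le
    rw [Finset.sum_congr rfl fun b _ => congrArg ((1 + coeffC (d b) (n b) + d b) * ·)
      (Finset.sum_congr rfl fun i hi => hweight b i hi), h2]
    linarith

theorem KInvariant.accept (hk : 2 ≤ k) (hf : KSubmodular f) (hn : ∀ a, 1 ≤ n a)
    (hd : ∀ a, 1 / 2 ≤ d a) {s : KState k V} {acc U : KTuple k V}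
    (h : KInvariant f n d O T s acc U) {t : V} (ht : t ∉ T) {a : Fin k}
    (ha : ∀ b, modGain f s t b ≤ modGain f s t a) (hw : s.beta a ≤ marginal f s.sol t a)
    {w : V → Fin k → ℝ}
    (hwdef : w = Function.update s.weight t (fun b => marginal f s.sol t b)) {i : V}
    (hi : (s.sol.part a).Nonempty → i ∈ s.sol.part a ∧ ∀ j ∈ s.sol.part a, w i a ≤ w j a)
    {S' : KTuple k V} (hSa : S'.part a = replaceMin (n a) (s.sol.part a) i t)
    (hSb : ∀ b, b ≠ a → S'.part b = s.sol.part b) :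
    KInvariant f n d O (insert t T)
      { sol := S', weight := w,
        beta := Function.update s.beta a (threshold (d a) (n a) (S'.part a) (fun i => w i a)) }
      (acc.assign t a) (U.assign t a) := by
  have htacc : ∀ b, t ∉ acc.part b := fun b hb => ht (h.acc_seen b hb)
  have htsol : ∀ b, t ∉ s.sol.part b := fun b hb => htacc b (h.sol_subset b hb)
  have hβ := h.beta_nonneg hn hd
  have hweight : ∀ b, ∀ j ∈ s.sol.part b, w j b = s.weight j b := by
    intro b j hj
    rw [hwdef, Function.update_of_ne fun hjt : j = t => htsol b (hjt ▸ hj)]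
  have hwt : ∀ b, w t b = marginal f s.sol t b := fun b => by rw [hwdef, Function.update_self]
  have hthr : threshold (d a) (n a) (s.sol.part a) (fun i => w i a) = s.beta a := by
    rw [h.beta_eq a]; exact threshold_congr _ _ (hweight a)
  have heff := acceptEffect_replaceMin (d := d a) (by linarith [hd a]) (hn a) (h.card_le a)
    (w := fun i => w i a) (fun j hj => by rw [hweight a j hj]; exact h.weight_nonneg a j hj)
    (htsol a) (by rw [hthr, hwt]; exact hw) hi
  rw [← hSa] at heff
  set m := disposedWeight (n a) (s.sol.part a) (fun i => w i a) i
  set β' := threshold (d a) (n a) (S'.part a) (fun i => w i a) with hβ'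
  have hSsub : S'.part a ⊆ insert t (s.sol.part a) := by
    rw [hSa, replaceMin]
    split_ifs
    exacts [subset_rfl, Finset.insert_subset_insert _ (Finset.erase_subset _ _)]
  have htS' : ∀ b, b ≠ a → t ∉ S'.part b := fun b hb => by rw [hSb b hb]; exact htsol b
  have hUa : ∀ b, b ≠ a → ∀ x, x ∈ (U.assign t a).part b ↔ x ≠ t ∧ x ∈ U.part b := by
    intro b hb x
    rw [KTuple.part_assign_of_ne U t hb, Finset.mem_erase]
  have haccb : ∀ b, b ≠ a → (acc.assign t a).part b = acc.part b := by
    intro b hb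
    rw [KTuple.part_assign_of_ne acc t hb, Finset.erase_eq_of_notMem (htacc b)]
  refine ⟨?_, ?_, ?_, ?_, ?_, ?_, ?_, ?_, ?_, ?_⟩
  · intro b
    by_cases hb : b = a
    · subst hb
      rw [KTuple.part_assign_self]
      exact hSsub.trans (Finset.insert_subset_insert _ (h.sol_subset b))
    · simp only [hSb b hb, haccb b hb]; exact h.sol_subset b
  · intro b
    by_cases hb : b = a
    · subst hb
      rw [KTuple.part_assign_self, KTuple.part_assign_self]
      exact Finset.insert_subset_insert _ (h.acc_subset b)
    · intro x hx
      rw [haccb b hb] at hx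
      rw [hUa b hb]
      exact ⟨fun hxt => htacc b (hxt ▸ hx), h.acc_subset b hx⟩
  · intro b
    by_cases hb : b = a
    · subst hb
      rw [KTuple.part_assign_self]
      exact Finset.insert_subset_insert _ (h.acc_seen b)
    · rw [haccb b hb]; exact (h.acc_seen b).trans (Finset.subset_insert _ _)
  · intro b x hx hxU
    by_cases hb : b = a
    · subst hb
      rw [KTuple.part_assign_self, Finset.mem_insert] at hxU ⊢
      by_cases hxt : x = t
      · exact Or.inl hxt
      · exact Or.inr (h.seen_mem b x (Finset.mem_of_mem_insert_of_ne hx hxt)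
          (hxU.resolve_left hxt))
    · rw [hUa b hb] at hxU
      rw [haccb b hb]
      exact h.seen_mem b x (Finset.mem_of_mem_insert_of_ne hx hxU.1) hxU.2
  · intro b x hx
    rw [Finset.mem_insert, not_or] at hx
    rw [← h.unseen_mem b x hx.2]
    by_cases hb : b = a
    · subst hb
      rw [KTuple.part_assign_self, Finset.mem_insert]
      exact ⟨fun h => h.resolve_left hx.1, Or.inr⟩
    · rw [hUa b hb]
      exact ⟨fun h => h.2, fun h => ⟨hx.1, h⟩⟩
  · intro b
    by_cases hb : b = a
    · subst hb; exact heff.card_le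
    · simp only [hSb b hb]; exact h.card_le b
  · intro b j hj
    simp only at hj ⊢
    by_cases hb : b = a
    · subst hb
      rcases Finset.mem_insert.1 (hSsub hj) with rfl | hj
      · rw [hwt]; exact (hβ b).trans hw
      · rw [hweight b j hj]; exact h.weight_nonneg b j hj
    · rw [hSb b hb] at hj
      rw [hweight b j hj]; exact h.weight_nonneg b j hj
  · intro b
    by_cases hb : b = a
    · subst hb; simp [hβ']
    · simp only [Function.update_of_ne hb, hSb b hb]
      rw [h.beta_eq b]
      exact (threshold_congr _ _ (hweight b)).symm
  · intro X hX
    simp only at hX ⊢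
    have hXt : ∀ b, b ≠ a → t ∉ X.part b := fun b hb hx => htS' b hb (hX b hx)
    have hY : ∀ b, (X.remove t).part b ⊆ s.sol.part b := by
      intro b x hx
      rw [KTuple.part_remove, Finset.mem_erase] at hx
      by_cases hb : b = a
      · subst hb; exact Finset.mem_of_mem_insert_of_ne (hSsub (hX b hx.2)) hx.1
      · rw [← hSb b hb]; exact hX b hx.2
    have hval := h.le_value _ hY
    rw [← Finset.sum_congr rfl fun b _ => Finset.sum_congr rfl fun i hi => hweight b i (hY b hi)]
      at hval
    -- The weight of `t` was measured against the whole old solution, so its gain over a smaller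
    -- tuple is at least as large.
    by_cases hXa : t ∈ X.part a
    · have h1 : f X = f (X.remove t) + marginal f (X.remove t) t a := by
        conv_lhs => rw [← KTuple.assign_eq_self hXa, ← KTuple.assign_remove]
        unfold marginal; ring
      have h2 := hf.marginal_anti hY htsol a
      have h3 : ∑ b, ∑ i ∈ X.part b, w i b
          = ∑ b, ∑ i ∈ (X.remove t).part b, w i b + marginal f s.sol t a := by
        refine sum_eq_sum_add_of_eq_of_ne (a := a) ?_ fun b hb => ?_
        · rw [KTuple.part_remove, ← hwt a, Finset.sum_erase_add _ _ hXa]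
        · rw [KTuple.part_remove, Finset.erase_eq_of_notMem (hXt b hb)]
      linarith
    · have : X.remove t = X := KTuple.remove_eq_self fun b => by
        by_cases hb : b = a
        exacts [hb ▸ hXa, hXt b hb]
      rwa [this] at hval
  · have h1 := (hf.value_sub_le hk hβ ha
      (fun b => (h.sol_subset b).trans (h.acc_subset b)) htsol).1 hw
    have h2 := O.sum_seenCard_insert ht fun b => s.beta b + minOthers s.beta b
    simp only [h.unseen_mem _ t ht] at h1
    have h3 := h.potential_le
    have h4 : f (acc.assign t a) - f acc ≤ marginal f s.sol t a :=
      hf.marginal_anti h.sol_subset htacc a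
    have hle := heff.threshold_le
    have hinc := heff.increase_le
    have hm0 := heff.disposed_nonneg
    simp only [hthr, hwt] at hle hinc
    have hβle : ∀ b, s.beta b ≤ Function.update s.beta a β' b := by
      intro b
      by_cases hb : b = a
      · subst hb; simpa using hle
      · simp [Function.update_of_ne hb]
    -- Old charges may be re-evaluated at the new, larger thresholds.
    have h5 : ∑ b, O.seenCard (insert t T) b * (s.beta b + minOthers s.beta b)
        ≤ ∑ b, O.seenCard (insert t T) b * (Function.update s.beta a β' b
          + minOthers (Function.update s.beta a β') b) :=
      Finset.sum_le_sum fun b _ => mul_le_mul_of_nonneg_left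
        (add_le_add (hβle b) (minOthers_mono hk hβle b)) (Nat.cast_nonneg _)
    have h6 : ∑ b, n b * Function.update s.beta a β' b
        = ∑ b, n b * s.beta b + n a * (β' - s.beta a) := by
      refine sum_eq_sum_add_of_eq_of_ne (a := a) ?_ fun b hb => ?_
      · rw [Function.update_self]; ring
      · rw [Function.update_of_ne hb]
    have h7 : ∑ b, (1 + coeffC (d b) (n b) + d b) * ∑ i ∈ S'.part b, w i b
        = ∑ b, (1 + coeffC (d b) (n b) + d b) * ∑ i ∈ s.sol.part b, s.weight i b
          + (1 + coeffC (d a) (n a) + d a) * (marginal f s.sol t a - m) := by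
      refine sum_eq_sum_add_of_eq_of_ne (a := a) ?_ fun b hb => ?_
      · rw [heff.sum_eq, hwt, Finset.sum_congr rfl (hweight a)]; ring
      · rw [hSb b hb, Finset.sum_congr rfl (hweight b)]
    simp only at h6 h7 ⊢
    rw [h6, h7]
    -- With w the accepted gain, the left side grows by w from `acc`, by 2w - β from `U`, and by
    -- twice the threshold bound. After cancellation, w - β ≤ 2d(w - β) is left; this is where d ≥
    -- 1/2 enters.
    have h8 := mul_nonneg (sub_nonneg.2 (hd a)) (sub_nonneg.2 hw)
    linarith

theorem KInvariant.step (hk : 2 ≤ k) (hf : KSubmodular f) (hn : ∀ a, 1 ≤ n a)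
    (hd : ∀ a, 1 / 2 ≤ d a) {amax : V → (Fin k → ℝ) → Fin k} (hamax : IsArgMaxRule amax)
    {amin : V → Finset V → (V → ℝ) → V} (hamin : IsArgMinRule amin)
    {s : KState k V} {acc U : KTuple k V}
    (h : KInvariant f n d O T s acc U) {t : V} (ht : t ∉ T) :
    ∃ acc' U', KInvariant f n d O (insert t T) (kStep f n d amax amin s t) acc' U' := by
  have htsol : ∀ b, t ∉ s.sol.part b := fun b hb => ht (h.acc_seen b (h.sol_subset b hb))
  have ha : ∀ b, modGain f s t b ≤ modGain f s t (amax t (modGain f s t)) := hamax t _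
  rw [kStep]
  generalize amax t (modGain f s t) = a at ha ⊢
  simp only [Function.update_self, sub_nonneg]
  have hmin := fun hne => hamin t (s.sol.part a)
    (fun i => Function.update s.weight t (fun b => marginal f s.sol t b) i a) hne
  split_ifs with hw hfull
  · refine ⟨_, _, h.accept hk hf hn hd ht ha hw rfl hmin ?_ ?_⟩
    · rw [KTuple.part_assign_self, replaceMin, if_pos hfull]
    · intro b hb
      rw [KTuple.part_assign_of_ne _ _ hb, Finset.erase_eq_of_notMem (htsol b)]
  · refine ⟨_, _, h.accept hk hf hn hd ht ha hw rfl hmin ?_ ?_⟩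
    · rw [KTuple.part_assign_self, replaceMin, if_neg hfull, KTuple.part_remove]
    · intro b hb
      have hne : (s.sol.part a).Nonempty := by
        rw [← Finset.card_pos]; have := hn a; omega
      rw [KTuple.part_assign_of_ne _ _ hb, KTuple.part_remove, Finset.erase_eq_of_notMem,
        Finset.erase_eq_of_notMem]
      · exact fun hmem => hb (KTuple.eq_of_mem_part hmem (hamin t _ _ hne).1)
      · exact fun hmem => htsol b (Finset.mem_of_mem_erase hmem)
  · exact ⟨_, _, h.reject hk hf hn hd ht ha (not_le.1 hw)⟩

theorem KInvariant.foldl (hk : 2 ≤ k) (hf : KSubmodular f) (hn : ∀ a, 1 ≤ n a)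
    (hd : ∀ a, 1 / 2 ≤ d a) {amax : V → (Fin k → ℝ) → Fin k} (hamax : IsArgMaxRule amax)
    {amin : V → Finset V → (V → ℝ) → V} (hamin : IsArgMinRule amin) (l : List V)
    {s : KState k V} {acc U : KTuple k V} (h : KInvariant f n d O T s acc U) (hl : l.Nodup)
    (hT : ∀ t ∈ l, t ∉ T) :
    ∃ acc' U', KInvariant f n d O (T ∪ l.toFinset) (l.foldl (kStep f n d amax amin) s) acc' U' := by
  induction l generalizing T s acc U with
  | nil => exact ⟨acc, U, by simpa using h⟩
  | cons t l ih =>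
    obtain ⟨acc', U', h'⟩ := h.step hk hf hn hd hamax hamin (hT t (by simp))
    have := ih h' hl.of_cons fun x hx hxT => by
      rcases Finset.mem_insert.1 hxT with rfl | hxT
      · exact (List.nodup_cons.1 hl).1 hx
      · exact hT x (by simp [hx]) hxT
    simpa [Finset.insert_union, Finset.union_insert] using this

variable {amax : V → (Fin k → ℝ) → Fin k} {amin : V → Finset V → (V → ℝ) → V} {order : List V}

theorem exists_kInvariant (hk : 2 ≤ k) (hf : KSubmodular f) (hn : ∀ a, 1 ≤ n a)
    (hd : ∀ a, 1 / 2 ≤ d a) (hamax : IsArgMaxRule amax) (hamin : IsArgMinRule amin)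
    (hnodup : order.Nodup) (O : KTuple k V) : ∃ s acc U, s.sol = kAlg f n d amax amin order ∧
      KInvariant f n d O order.toFinset s acc U := by
  obtain ⟨acc, U, h⟩ := (KInvariant.initial (f := f) (n := n) (d := d) (O := O)).foldl hk hf hn hd
    hamax hamin order hnodup (by simp)
  exact ⟨_, acc, U, rfl, by simpa using h⟩

theorem kAlg_feasible (hk : 2 ≤ k) (hf : KSubmodular f) (hn : ∀ a, 1 ≤ n a)
    (hd : ∀ a, 1 / 2 ≤ d a) (hamax : IsArgMaxRule amax) (hamin : IsArgMinRule amin)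
    (hnodup : order.Nodup) : KTuple.Feasible n (kAlg f n d amax amin order) := by
  obtain ⟨s, acc, U, hs, h⟩ := exists_kInvariant hk hf hn hd hamax hamin hnodup (KTuple.empty k V)
  exact hs ▸ h.card_le

/-- The guarantee for balanced budgets. -/
theorem le_mul_kAlg (hk : 2 ≤ k) (hf0 : ∀ X, 0 ≤ f X) (hf : KSubmodular f) (hn : ∀ a, 1 ≤ n a)
    (hd : ∀ a, 1 / 2 ≤ d a) (hamax : IsArgMaxRule amax) (hamin : IsArgMinRule amin)
    (hnodup : order.Nodup) (hall : ∀ t, t ∈ order)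
    (hbal : ∀ a, n a ≤ ∑ b ∈ Finset.univ.erase a, n b) (hO : KTuple.Feasible n O) {Q : ℝ}
    (hQ : ∀ a, 1 + coeffC (d a) (n a) + d a ≤ Q) :
    f O ≤ 2 * Q * f (kAlg f n d amax amin order) := by
  obtain ⟨s, acc, U, hs, h⟩ := exists_kInvariant hk hf hn hd hamax hamin hnodup O
  rw [← hs]
  have hU : U = acc := by
    ext a t
    exact ⟨h.seen_mem a t (by simp [hall t]), fun ht => h.acc_subset a ht⟩
  have h1 := h.potential_le
  have hβ := h.beta_nonneg hn hd
  rw [hU] at h1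
  -- Balance of the budgets pays for all charges.
  have h2 : ∑ b, O.seenCard order.toFinset b * (s.beta b + minOthers s.beta b)
      ≤ 2 * ∑ a, n a * s.beta a := by
    have : ∑ b, O.seenCard order.toFinset b * (s.beta b + minOthers s.beta b)
        ≤ ∑ b, n b * (s.beta b + minOthers s.beta b) := by
      refine Finset.sum_le_sum fun b _ => mul_le_mul_of_nonneg_right ?_
        (add_nonneg (hβ b) (minOthers_nonneg hk hβ b))
      exact_mod_cast (Finset.card_filter_le _ _).trans (hO b)
    simp only [mul_add, Finset.sum_add_distrib] at this ⊢
    linarith [sum_mul_minOthers_le hk s.beta n hbal]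
  have h3 := h.le_value s.sol fun _ => subset_rfl
  have h4 : ∑ a, (1 + coeffC (d a) (n a) + d a) * ∑ i ∈ s.sol.part a, s.weight i a
      ≤ Q * ∑ a, ∑ i ∈ s.sol.part a, s.weight i a := by
    rw [Finset.mul_sum]
    exact Finset.sum_le_sum fun a _ => mul_le_mul_of_nonneg_right (hQ a)
      (Finset.sum_nonneg (h.weight_nonneg a))
  have hQ1 : 1 ≤ Q := by
    have a : Fin k := ⟨0, by omega⟩
    linarith [hQ a, coeffC_pos (d := d a) (by linarith [hd a]) (hn a), hd a]
  have h5 := mul_le_mul_of_nonneg_left h3 (show 0 ≤ 2 * Q by linarith)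
  have h6 := mul_nonneg (show 0 ≤ 2 * Q - 1 by linarith) (hf0 (KTuple.empty k V))
  linarith

end

/-! ### Independent coins -/

section

variable {V : Type*} [Fintype V]

/-- The probability of the outcome `z` of independent coins of bias `p`. -/
def coinWeight (p : ℝ) (z : V → Bool) : ℝ :=
  ∏ t, if z t = true then p else 1 - p

theorem coinWeight_nonneg {p : ℝ} (hp0 : 0 ≤ p) (hp1 : p ≤ 1) (z : V → Bool) :
    0 ≤ coinWeight p z := by
  refine Finset.prod_nonneg fun t _ => ?_
  split_ifs <;> linarith

variable [DecidableEq V]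

theorem sum_coinWeight (p : ℝ) : ∑ z : V → Bool, coinWeight p z = 1 := by
  have := Finset.prod_univ_sum (fun _ : V => (Finset.univ : Finset Bool))
    (fun _ b => if b = true then p else 1 - p)
  rw [Fintype.piFinset_univ] at this
  simp only [coinWeight]
  rw [← this]
  simp

theorem sum_coinWeight_mul_eq_zero {p : ℝ} (hp0 : 0 < p) (t : V) (G : (V → Bool) → ℝ)
    (hG : ∀ z b, G (Function.update z t b) = G z) :
    ∑ z, coinWeight p z * (G z * if z t = true then 1 / p - 1 else -1) = 0 := by
  -- Pair the outcomes that differ only in the coin of `t`: p(1/p - 1) and -(1 - p) cancel.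
  refine Finset.sum_involution (fun z _ => Function.update z t (!z t)) ?_ ?_ ?_ ?_
  · intro z _
    have h1 : ∀ z : V → Bool, coinWeight p z = (if z t = true then p else 1 - p) *
        ∏ s ∈ Finset.univ.erase t, if z s = true then p else 1 - p := fun z =>
      (Finset.mul_prod_erase _ _ (Finset.mem_univ t)).symm
    have h2 : (∏ s ∈ Finset.univ.erase t,
          if Function.update z t (!z t) s = true then p else 1 - p)
        = ∏ s ∈ Finset.univ.erase t, if z s = true then p else 1 - p :=
      Finset.prod_congr rfl fun s hs => by
        rw [Function.update_of_ne (Finset.ne_of_mem_erase hs)]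
    rw [h1, h1, h2, hG, Function.update_self]
    cases z t <;> simp <;> field_simp <;> ring
  · intro z _ _ h
    have := congrFun h t
    simp at this
  · simp
  · intro z _
    simp

theorem sum_coinWeight_ite {p : ℝ} (hp0 : 0 < p) (t : V) :
    (∑ z : V → Bool, coinWeight p z * if z t = true then 1 else 0) = p := by
  have h := sum_coinWeight_mul_eq_zero hp0 t (fun _ => 1) fun _ _ => rfl
  have h1 : ∀ z : V → Bool, coinWeight p z * (1 * if z t = true then 1 / p - 1 else -1)
      = 1 / p * (coinWeight p z * if z t = true then 1 else 0) - coinWeight p z := by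
    intro z; split_ifs <;> ring
  rw [Finset.sum_congr rfl fun z _ => h1 z, Finset.sum_sub_distrib, ← Finset.mul_sum,
    sum_coinWeight, sub_eq_zero] at h
  field_simp at h
  linarith

/-- A random set that contains every item with probability at most `p` decreases the expected value
of a nonnegative submodular function at most by the factor `1 - p`. -/
theorem one_sub_mul_le_sum_of_random {ι : Type*} [Fintype ι] (W : ι → ℝ) (hW : ∀ z, 0 ≤ W z)
    (hW1 : ∑ z, W z = 1) (h : Finset V → ℝ) (h0 : ∀ S, 0 ≤ h S)
    (hsub : ∀ S T t, S ⊆ T → t ∉ T → h (insert t T) - h T ≤ h (insert t S) - h S)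
    (R : ι → Finset V) {p : ℝ} (hp0 : 0 ≤ p)
    (hR : ∀ t, (∑ z, W z * if t ∈ R z then 1 else 0) ≤ p) :
    (1 - p) * h ∅ ≤ ∑ z, W z * h (R z) := by
  set x : V → ℝ := fun t => ∑ z, W z * if t ∈ R z then 1 else 0 with hx
  -- Items are added in order of decreasing probability. The bound y stays free because the next
  -- step uses it at the probability of the new item, whose term then cancels the one in `h s`.
  have key : ∀ s : Finset V, ∀ y : ℝ, y ≤ p → (∀ t ∈ s, y ≤ x t) →
      (1 - p) * h ∅ + y * h s ≤ ∑ z, W z * h (R z ∩ s) := by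
    intro s
    induction s using Finset.induction_on_min_value x with
    | empty =>
      intro y hy _
      simp only [Finset.inter_empty, ← Finset.sum_mul, hW1]
      nlinarith [h0 ∅]
    | insert a s ha hmin ih =>
      intro y _ hys
      have h1 := ih (x a) (hR a) hmin
      have h2 : ∑ z, W z * h (R z ∩ s) + x a * (h (insert a s) - h s)
          ≤ ∑ z, W z * h (R z ∩ insert a s) := by
        rw [hx, Finset.sum_mul, ← Finset.sum_add_distrib]
        refine Finset.sum_le_sum fun z _ => ?_
        rw [mul_assoc, ← mul_add]
        refine mul_le_mul_of_nonneg_left ?_ (hW z)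
        split_ifs with haz
        · rw [Finset.inter_insert_of_mem haz]
          linarith [hsub (R z ∩ s) s a Finset.inter_subset_right ha]
        · rw [Finset.inter_insert_of_notMem haz]; simp
      have h3 := mul_le_mul_of_nonneg_right (hys a (Finset.mem_insert_self _ _)) (h0 (insert a s))
      linarith
  simpa using key Finset.univ 0 hp0 fun t _ =>
    Finset.sum_nonneg fun z _ => mul_nonneg (hW z) (by split_ifs <;> simp)

end

/-! ### Analysis of the subsampled algorithm -/

section

variable {V : Type*} [DecidableEq V]

theorem pStep_one (g : Finset V → ℝ) (n : Fin 1 → ℕ) (d : Fin 1 → ℝ)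
    (amin : V → Finset V → (V → ℝ) → V) (z : V → Bool) (s : PState 1 V) (t : V) :
    pStep g (fun _ => 0) n d amin z s t =
      if s.beta 0 ≤ g (insert t s.sol) - g s.sol ∧ z t = true then
        { sol := replaceMin (n 0) s.sol
            (amin t s.sol (Function.update s.weight t (g (insert t s.sol) - g s.sol))) t
          weight := Function.update s.weight t (g (insert t s.sol) - g s.sol)
          beta := Function.update s.beta 0 (threshold (d 0) (n 0) (replaceMin (n 0) s.sol
            (amin t s.sol (Function.update s.weight t (g (insert t s.sol) - g s.sol))) t)
            (Function.update s.weight t (g (insert t s.sol) - g s.sol))) }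
      else { s with weight := Function.update s.weight t (g (insert t s.sol) - g s.sol) } := by
  simp [pStep, replaceMin]

/-- A state of the algorithm with the set of the accepted items and the balance of the coins of the
items of `O` that reach the threshold. -/
structure PTrace (V : Type*) where
  state : PState 1 V
  acc : Finset V
  balance : ℝ

/-- The step of the algorithm on traces. -/
noncomputable def PTrace.step (g : Finset V → ℝ) (n : Fin 1 → ℕ) (d : Fin 1 → ℝ)
    (amin : V → Finset V → (V → ℝ) → V) (p : ℝ) (O : Finset V) (z : V → Bool)
    (x : PTrace V) (t : V) : PTrace V where
  state := pStep g (fun _ => 0) n d amin z x.state t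
  acc := if x.state.beta 0 ≤ g (insert t x.state.sol) - g x.state.sol ∧ z t = true
    then insert t x.acc else x.acc
  balance := x.balance + (if t ∈ O ∧ x.state.beta 0 ≤ g (insert t x.state.sol) - g x.state.sol
    then g (insert t x.state.sol) - g x.state.sol - x.state.beta 0 else 0)
    * if z t = true then 1 / p - 1 else -1

/-- The trace of the algorithm on the stream `l`. -/
noncomputable def PTrace.run (g : Finset V → ℝ) (n : Fin 1 → ℕ) (d : Fin 1 → ℝ)
    (amin : V → Finset V → (V → ℝ) → V) (p : ℝ) (O : Finset V) (l : List V) (z : V → Bool) :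
    PTrace V :=
  l.foldl (PTrace.step g n d amin p O z)
    { state := { sol := ∅, weight := fun _ => 0, beta := fun _ => 0 }, acc := ∅, balance := 0 }

variable {g : Finset V → ℝ} {n : Fin 1 → ℕ} {d : Fin 1 → ℝ}
  {amin : V → Finset V → (V → ℝ) → V} {p : ℝ} {O : Finset V}

theorem PTrace.run_append (l : List V) (t : V) (z : V → Bool) :
    PTrace.run g n d amin p O (l ++ [t]) z
      = PTrace.step g n d amin p O z (PTrace.run g n d amin p O l z) t := by
  simp [PTrace.run]

theorem PTrace.sol_run (l : List V) (z : V → Bool) :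
    (PTrace.run g n d amin p O l z).state.sol = pAlg g (fun _ => 0) n d amin z l := by
  suffices h : (PTrace.run g n d amin p O l z).state = l.foldl (pStep g (fun _ => 0) n d amin z)
      { sol := ∅, weight := fun _ => 0, beta := fun _ => 0 } by rw [h]; rfl
  induction l using List.reverseRecOn with
  | nil => rfl
  | append_singleton l t ih => rw [PTrace.run_append]; simp [PTrace.step, ih]

/-- A coin is read only when its item arrives; hence the gain and threshold met by an item do not
depend on its own coin. -/
theorem PTrace.run_congr (l : List V) {z z' : V → Bool} (h : ∀ t ∈ l, z t = z' t) :
    PTrace.run g n d amin p O l z = PTrace.run g n d amin p O l z' := by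
  induction l using List.reverseRecOn with
  | nil => rfl
  | append_singleton l t ih =>
    rw [PTrace.run_append, PTrace.run_append, ih fun s hs => h s (by simp [hs])]
    simp [PTrace.step, pStep, h t (by simp)]

/-- The balance is a martingale: each increment is a function of earlier coins times a zero-mean
function of the new one. -/
theorem PTrace.sum_balance_run [Fintype V] (hp0 : 0 < p) (l : List V) (hl : l.Nodup) :
    ∑ z, coinWeight p z * (PTrace.run g n d amin p O l z).balance = 0 := by
  induction l using List.reverseRecOn with
  | nil => simp [PTrace.run]
  | append_singleton l t ih =>
    have htl : t ∉ l := by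
      rw [List.nodup_append] at hl
      exact fun h => hl.2.2 t h t (by simp) rfl
    simp only [PTrace.run_append, PTrace.step, mul_add, Finset.sum_add_distrib]
    rw [ih (List.nodup_append.1 hl).1, zero_add]
    refine sum_coinWeight_mul_eq_zero hp0 t (fun z =>
      if t ∈ O ∧ (PTrace.run g n d amin p O l z).state.beta 0
          ≤ g (insert t (PTrace.run g n d amin p O l z).state.sol)
            - g (PTrace.run g n d amin p O l z).state.sol
      then g (insert t (PTrace.run g n d amin p O l z).state.sol)
        - g (PTrace.run g n d amin p O l z).state.sol
        - (PTrace.run g n d amin p O l z).state.beta 0 else 0) fun z b => ?_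
    rw [PTrace.run_congr l fun s hs => Function.update_of_ne (fun h : s = t => htl (h ▸ hs)) b z]

/-- What is maintained by the algorithm. -/
structure PInvariant (g : Finset V → ℝ) (n : Fin 1 → ℕ) (d : Fin 1 → ℝ) (O : Finset V) (Q : ℝ)
    (z : V → Bool) (T : Finset V) (x : PTrace V) : Prop where
  sol_subset : x.state.sol ⊆ x.acc
  acc_seen : x.acc ⊆ T
  acc_coin : ∀ t ∈ x.acc, z t = true
  card_le : x.state.sol.card ≤ n 0
  weight_nonneg : ∀ i ∈ x.state.sol, 0 ≤ x.state.weight i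
  beta_eq : x.state.beta 0 = threshold (d 0) (n 0) x.state.sol x.state.weight
  le_value : ∀ X ⊆ x.state.sol, g ∅ + ∑ i ∈ X, x.state.weight i ≤ g X
  -- Each seen item of `O` has been paid one β out of the reserve of n; what remains is nonnegative
  -- at the end because |O| ≤ n.
  potential_le : g (x.acc ∪ O ∩ T) + ((n 0 : ℝ) - (O ∩ T).card) * x.state.beta 0 + x.balance
    ≤ g ∅ + Q * ∑ i ∈ x.state.sol, x.state.weight i

/-- After inserting the threshold bound, the left side is affine in β on [m, w] with slope (1 -
1/N)d - 1/p. The end β = m gives the term (1 - 1/N)c + 1/p of Q, and β = w is covered by 1 + c + d.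
-/
theorem potential_increase_le {N c d p Q w β β' m : ℝ} (hN : 1 ≤ N) (hc : 0 ≤ c) (hd : 0 ≤ d)
    (hQ1 : 1 + c + d ≤ Q) (hQ2 : (1 - 1 / N) * c + 1 / p ≤ Q) (hm0 : 0 ≤ m) (hmβ : m ≤ β)
    (hβw : β ≤ w) (h : N * (β' - β) ≤ c * (w - m) + d * β - (1 + d) * m) :
    w + N * (β' - β) - β' + (w - β) * (1 / p - 1) ≤ Q * (w - m) := by
  set e := 1 - 1 / N with he
  have hN0 : 0 < N := by linarith
  have he0 : 0 ≤ e := by rw [he, sub_nonneg, div_le_one hN0]; exact hN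
  have he1 : e ≤ 1 := by rw [he]; linarith [div_pos one_pos hN0]
  have h1 : N * (β' - β) - β' ≤ e * (c * (w - m) + d * β - (1 + d) * m) - β := by
    have := mul_le_mul_of_nonneg_left h he0
    have h2 : e * (N * (β' - β)) = N * (β' - β) - (β' - β) := by rw [he]; field_simp
    linarith
  have hem := mul_nonneg he0 hm0
  rcases le_total (e * d) (1 / p) with h2 | h2
  · have h3 := mul_le_mul_of_nonneg_right hQ2 (show 0 ≤ w - m by linarith)
    nlinarith [mul_nonneg (sub_nonneg.2 h2) (sub_nonneg.2 hmβ)]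
  · have h3 := mul_le_mul_of_nonneg_right hQ1 (show 0 ≤ w - m by linarith)
    have h4 := mul_nonneg (mul_nonneg (sub_nonneg.2 he1) (add_nonneg hc hd))
      (show 0 ≤ w - m by linarith)
    nlinarith [mul_nonneg (sub_nonneg.2 h2) (sub_nonneg.2 hβw)]

variable {Q : ℝ} {z : V → Bool} {T : Finset V}

theorem PInvariant.step {x : PTrace V} (h : PInvariant g n d O Q z T x)
    (hsub : ∀ S T t, S ⊆ T → t ∉ T → g (insert t T) - g T ≤ g (insert t S) - g S)
    (hamin : IsArgMinRule amin) (hn : 1 ≤ n 0) (hd : 0 < d 0)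
    (hQ1 : 1 + coeffC (d 0) (n 0) + d 0 ≤ Q)
    (hQ2 : (1 - 1 / (n 0 : ℝ)) * coeffC (d 0) (n 0) + 1 / p ≤ Q) {t : V} (ht : t ∉ T) :
    PInvariant g n d O Q z (insert t T) (PTrace.step g n d amin p O z x t) := by
  have htacc : t ∉ x.acc := fun hx => ht (h.acc_seen hx)
  have htsol : t ∉ x.state.sol := fun hx => htacc (h.sol_subset hx)
  set w := Function.update x.state.weight t (g (insert t x.state.sol) - g x.state.sol) with hwdef
  have hwt : w t = g (insert t x.state.sol) - g x.state.sol := by rw [hwdef, Function.update_self]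
  have hweight : ∀ i ∈ x.state.sol, w i = x.state.weight i := by
    intro i hi
    rw [hwdef, Function.update_of_ne fun hit : i = t => htsol (hit ▸ hi)]
  have hβ : 0 ≤ x.state.beta 0 := by
    rw [h.beta_eq]; exact threshold_nonneg hd hn h.card_le h.weight_nonneg
  have htU : t ∉ x.acc ∪ O ∩ T := by simp [htacc, ht]
  have hgain := hsub x.state.sol (x.acc ∪ O ∩ T) t
    (h.sol_subset.trans Finset.subset_union_left) htU
  rw [← hwt] at hgain
  have hcard : (O ∩ insert t T).card = (O ∩ T).card + if t ∈ O then 1 else 0 := by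
    split_ifs with htO
    · rw [Finset.inter_insert_of_mem htO, Finset.card_insert_of_notMem (by simp [ht])]
    · rw [Finset.inter_insert_of_notMem htO, add_zero]
  have hpot := h.potential_le
  by_cases hacc : x.state.beta 0 ≤ w t ∧ z t = true
  · obtain ⟨hw, hz⟩ := hacc
    have hx : PTrace.step g n d amin p O z x t =
        { state :=
          { sol := replaceMin (n 0) x.state.sol (amin t x.state.sol w) t
            weight := w
            beta := Function.update x.state.beta 0 (threshold (d 0) (n 0)
              (replaceMin (n 0) x.state.sol (amin t x.state.sol w) t) w) }
          acc := insert t x.acc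
          balance := x.balance + (if t ∈ O then w t - x.state.beta 0 else 0) * (1 / p - 1) } := by
      rw [hwt] at hw
      simp only [PTrace.step, pStep_one, hw, hz, hwt, and_self, and_true, if_true]
      rfl
    have hthr : threshold (d 0) (n 0) x.state.sol w = x.state.beta 0 := by
      rw [h.beta_eq]; exact threshold_congr _ _ hweight
    have heff := acceptEffect_replaceMin hd hn h.card_le (w := w)
      (fun j hj => by rw [hweight j hj]; exact h.weight_nonneg j hj)
      htsol (by rw [hthr]; exact hw) (hamin t x.state.sol w)
    have hSsub : replaceMin (n 0) x.state.sol (amin t x.state.sol w) t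
        ⊆ insert t x.state.sol := by
      rw [replaceMin]
      split_ifs
      exacts [subset_rfl, Finset.insert_subset_insert _ (Finset.erase_subset _ _)]
    rw [hx]
    set m := disposedWeight (n 0) x.state.sol w (amin t x.state.sol w)
    set S' := replaceMin (n 0) x.state.sol (amin t x.state.sol w) t
    have hle := heff.threshold_le
    have hinc := heff.increase_le
    have hmβ := heff.disposed_le
    simp only [hthr] at hle hinc hmβ
    refine ⟨hSsub.trans (Finset.insert_subset_insert _ h.sol_subset),
      Finset.insert_subset_insert _ h.acc_seen, ?_, heff.card_le, ?_, by simp, ?_, ?_⟩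
    · intro s hs
      rcases Finset.mem_insert.1 hs with rfl | hs
      exacts [hz, h.acc_coin s hs]
    · intro j hj
      rcases Finset.mem_insert.1 (hSsub hj) with rfl | hj
      · exact hβ.trans hw
      · exact (h.weight_nonneg j hj).trans_eq (hweight j hj).symm
    · intro X hX
      have hY : X.erase t ⊆ x.state.sol := fun y hy =>
        Finset.mem_of_mem_insert_of_ne (hSsub (hX (Finset.mem_of_mem_erase hy)))
          (Finset.ne_of_mem_erase hy)
      have hval := h.le_value _ hY
      rw [← Finset.sum_congr rfl fun i hi => hweight i (hY hi)] at hval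
      by_cases hXt : t ∈ X
      · have h2 := hsub _ _ t hY htsol
        rw [Finset.insert_erase hXt] at h2
        rw [← Finset.sum_erase_add _ _ hXt]
        linarith
      · rwa [Finset.erase_eq_of_notMem hXt] at hval
    · have h1 : g (insert t x.acc ∪ O ∩ insert t T)
          ≤ g (x.acc ∪ O ∩ T) + w t := by
        have : insert t x.acc ∪ O ∩ insert t T = insert t (x.acc ∪ O ∩ T) := by
          ext y; simp only [Finset.mem_union, Finset.mem_insert, Finset.mem_inter]; tauto
        rw [this]; linarith
      simp only [Function.update_self]
      rw [heff.sum_eq, Finset.sum_congr rfl hweight, hcard]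
      -- The threshold increase multiplied by |O ∩ T| has a favourable sign and is dropped.
      have hm := mul_nonneg (Nat.cast_nonneg (α := ℝ) (O ∩ T).card) (sub_nonneg.2 hle)
      split_ifs with htO
      · have := potential_increase_le (by exact_mod_cast hn) (coeffC_pos hd hn).le hd.le hQ1 hQ2
          heff.disposed_nonneg hmβ hw hinc
        push_cast
        linarith
      · have h2 := mul_le_mul_of_nonneg_right hQ1 (sub_nonneg.2 (hmβ.trans hw))
        have h3 := mul_nonneg hd.le (sub_nonneg.2 hw)
        simp only [add_zero, zero_mul]
        linarith
  · have hx : PTrace.step g n d amin p O z x t =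
        { state := { x.state with weight := w }
          acc := x.acc
          balance := x.balance - if t ∈ O ∧ x.state.beta 0 ≤ w t
            then w t - x.state.beta 0 else 0 } := by
      simp only [PTrace.step, pStep_one, ← hwt, if_neg hacc, PTrace.mk.injEq, true_and]
      by_cases hz : z t = true
      · have : ¬ x.state.beta 0 ≤ w t := fun h => hacc ⟨h, hz⟩
        simp only [this, and_false, if_false, zero_mul, sub_zero, add_zero, and_true]
        rw [hwt]
      · simp [hz, sub_eq_add_neg]
        rw [hwt]
    rw [hx]
    refine ⟨h.sol_subset, h.acc_seen.trans (Finset.subset_insert _ _), h.acc_coin, h.card_le,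
      fun i hi => (h.weight_nonneg i hi).trans_eq (hweight i hi).symm, ?_, ?_, ?_⟩
    · exact h.beta_eq.trans (threshold_congr _ _ hweight).symm
    · intro X hX
      simp only at hX ⊢
      rw [Finset.sum_congr rfl fun i hi => hweight i (hX hi)]
      exact h.le_value X hX
    · simp only
      rw [Finset.sum_congr rfl hweight, hcard]
      by_cases htO : t ∈ O
      · have h1 : g (x.acc ∪ O ∩ insert t T) ≤ g (x.acc ∪ O ∩ T) + w t := by
          rw [Finset.inter_insert_of_mem htO, Finset.union_insert]; linarith
        simp only [htO, true_and, if_true]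
        push_cast
        -- At or above the threshold, gain w, released β and balance -(w - β) cancel exactly; below
        -- it, w < β suffices.
        split_ifs with hw
        · linarith
        · linarith
      · simp only [htO, false_and, if_false, Finset.inter_insert_of_notMem htO]
        simpa using hpot

theorem PInvariant.run (hsub : ∀ S T t, S ⊆ T → t ∉ T → g (insert t T) - g T
      ≤ g (insert t S) - g S)
    (hamin : IsArgMinRule amin) (hn : 1 ≤ n 0) (hd : 0 < d 0)
    (hQ1 : 1 + coeffC (d 0) (n 0) + d 0 ≤ Q)
    (hQ2 : (1 - 1 / (n 0 : ℝ)) * coeffC (d 0) (n 0) + 1 / p ≤ Q) (l : List V) (hl : l.Nodup)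
    (z : V → Bool) :
    PInvariant g n d O Q z l.toFinset (PTrace.run g n d amin p O l z) := by
  induction l using List.reverseRecOn with
  | nil =>
    refine ⟨subset_rfl, by simp [PTrace.run], by simp [PTrace.run], by simp [PTrace.run],
      by simp [PTrace.run], by simp [PTrace.run, threshold_empty], fun X hX => ?_,
      by simp [PTrace.run]⟩
    rw [Finset.subset_empty.1 hX]; simp
  | append_singleton l t ih =>
    have htl : t ∉ l := by
      rw [List.nodup_append] at hl
      exact fun h => hl.2.2 t h t (by simp) rfl
    have := (ih (List.nodup_append.1 hl).1).step hsub hamin hn hd hQ1 hQ2 (t := t)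
      (by simpa using htl)
    rw [PTrace.run_append]
    have hT : (l ++ [t]).toFinset = insert t l.toFinset := by ext; simp
    rwa [hT]

theorem card_pAlg_le (hsub : ∀ S T t, S ⊆ T → t ∉ T → g (insert t T) - g T
      ≤ g (insert t S) - g S)
    (hamin : IsArgMinRule amin) (hn : 1 ≤ n 0) (hd : 0 < d 0) (l : List V) (hl : l.Nodup)
    (z : V → Bool) : (pAlg g (fun _ => 0) n d amin z l).card ≤ n 0 := by
  have := (PInvariant.run (p := 1) (O := ∅) (Q := max _ _) hsub hamin hn hd
    (le_max_left _ _) (le_max_right _ _) l hl z).card_le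
  rwa [PTrace.sol_run] at this

/-- The guarantee of the subsampled algorithm for a cardinality constraint. -/
theorem one_sub_mul_le_sum_pAlg [Fintype V] (hg : ∀ S, 0 ≤ g S)
    (hsub : ∀ S T t, S ⊆ T → t ∉ T → g (insert t T) - g T ≤ g (insert t S) - g S)
    (hamin : IsArgMinRule amin) (hn : 1 ≤ n 0) (hd : 0 < d 0) (hO : O.card ≤ n 0)
    (hp0 : 0 < p) (hp1 : p ≤ 1)
    (hQ1 : 1 + coeffC (d 0) (n 0) + d 0 ≤ Q)
    (hQ2 : (1 - 1 / (n 0 : ℝ)) * coeffC (d 0) (n 0) + 1 / p ≤ Q) (l : List V) (hl : l.Nodup)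
    (hall : ∀ t, t ∈ l) :
    (1 - p) * g O ≤ Q * ∑ z, coinWeight p z * g (pAlg g (fun _ => 0) n d amin z l) := by
  have hinv := PInvariant.run (p := p) (O := O) hsub hamin hn hd hQ1 hQ2 l hl
  have hl' : l.toFinset = Finset.univ := by ext t; simp [hall t]
  have hcoin := coinWeight_nonneg hp0.le hp1 (V := V)
  have h1 := one_sub_mul_le_sum_of_random (coinWeight p) hcoin (sum_coinWeight p)
    (fun S => g (S ∪ O)) (fun S => hg _) ?_ (fun z => (PTrace.run g n d amin p O l z).acc) hp0.le
    fun t => ?_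
  · have h2 : ∀ z, coinWeight p z * g ((PTrace.run g n d amin p O l z).acc ∪ O)
        + coinWeight p z * (PTrace.run g n d amin p O l z).balance
        ≤ coinWeight p z * (Q * g (pAlg g (fun _ => 0) n d amin z l)) := by
      intro z
      rw [← mul_add]
      refine mul_le_mul_of_nonneg_left ?_ (hcoin z)
      have h3 := (hinv z).potential_le
      have h4 := (hinv z).le_value _ subset_rfl
      have hβ : 0 ≤ (PTrace.run g n d amin p O l z).state.beta 0 := by
        rw [(hinv z).beta_eq]; exact threshold_nonneg hd hn (hinv z).card_le (hinv z).weight_nonneg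
      rw [hl', Finset.inter_univ] at h3
      have h5 : (O.card : ℝ) ≤ n 0 := by exact_mod_cast hO
      have h6 := mul_nonneg (sub_nonneg.2 h5) hβ
      have hQ : 1 ≤ Q := by linarith [coeffC_pos hd hn]
      rw [← PTrace.sol_run (p := p) (O := O)]
      have h7 := mul_le_mul_of_nonneg_left h4 (zero_le_one.trans hQ)
      have h8 := mul_nonneg (sub_nonneg.2 hQ) (hg ∅)
      linarith
    have h3 := Finset.sum_le_sum fun z (_ : z ∈ Finset.univ) => h2 z
    rw [Finset.sum_add_distrib, PTrace.sum_balance_run hp0 l hl, add_zero] at h3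
    simp only [Finset.empty_union] at h1
    refine (h1.trans h3).trans_eq ?_
    rw [Finset.mul_sum]
    exact Finset.sum_congr rfl fun z _ => by ring
  -- Submodularity of S ↦ g(S ∪ O); items of `O` have zero gain.
  · intro S T t hST htT
    by_cases htO : t ∈ O
    · simp [Finset.insert_union, htO]
    · simp only [Finset.insert_union]
      exact hsub _ _ t (Finset.union_subset_union_left hST) (by simp [htT, htO])
  · refine le_trans ?_ (sum_coinWeight_ite hp0 t).le
    refine Finset.sum_le_sum fun z _ => mul_le_mul_of_nonneg_left ?_ (hcoin z)
    split_ifs with h1 h2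
    · exact le_rfl
    · exact absurd ((hinv z).acc_coin t h1) h2
    · exact zero_le_one
    · exact le_rfl

end

/-! ### Numerical bounds -/

theorem one_add_coeffC_add (d : ℝ) (n : ℕ) :
    1 + coeffC d n + d = (1 + d) * (1 + 1 / ((1 + d / n) ^ n - 1)) := by
  rw [coeffC]; ring

/-- From log(1 + x) ≥ 2x/(x + 2) ≥ x - x²/2 at x = d/n. -/
theorem exp_le_one_add_div_pow {d : ℝ} {n : ℕ} (hd : 0 < d) (hn : 1 ≤ n) :
    Real.exp (d - d ^ 2 / (2 * n)) ≤ (1 + d / n) ^ n := by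
  have hn' : (0 : ℝ) < n := by exact_mod_cast hn
  have hx : 0 < d / n := div_pos hd hn'
  have h1 := Real.le_log_one_add_of_nonneg hx.le
  have h2 : d / n - (d / n) ^ 2 / 2 ≤ 2 * (d / n) / (d / n + 2) := by
    rw [le_div_iff₀ (by linarith)]
    nlinarith [pow_pos hx 3]
  have h3 : d - d ^ 2 / (2 * n) = n * (d / n - (d / n) ^ 2 / 2) := by field_simp
  rw [h3, Real.exp_nat_mul]
  refine pow_le_pow_left₀ (Real.exp_pos _).le ?_ n
  rw [← Real.exp_log (show 0 < 1 + d / n by linarith)]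
  exact Real.exp_le_exp.2 (h2.trans h1)

/-- With y = d²/(2n) ≤ ε, use exp y ≤ 1 + y + y² ≤ 1 + (1 + ε)y. The result is affine in 1/n, like
the stated guarantees. -/
theorem one_div_pow_le {d : ℝ} {n : ℕ} (hd : 0 < d) (hn : 1 ≤ n) {ε : ℝ} (hε : ε ≤ 1)
    (hdn : d ^ 2 / (2 * n) ≤ ε) :
    1 / (1 + d / n) ^ n ≤ Real.exp (-d) * (1 + (1 + ε) * (d ^ 2 / (2 * n))) := by
  have h0 : 0 ≤ d ^ 2 / (2 * n) := by positivity
  have h1 := exp_le_one_add_div_pow hd hn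
  have h2 : 1 / (1 + d / n) ^ n ≤ Real.exp (-d) * Real.exp (d ^ 2 / (2 * n)) := by
    rw [← Real.exp_add, show -d + d ^ 2 / (2 * n) = -(d - d ^ 2 / (2 * n)) by ring,
      Real.exp_neg, ← one_div]
    exact one_div_le_one_div_of_le (Real.exp_pos _) h1
  refine h2.trans (mul_le_mul_of_nonneg_left ?_ (Real.exp_pos _).le)
  have h3 := abs_le.1 (Real.abs_exp_sub_one_sub_id_le (x := d ^ 2 / (2 * n))
    (by rw [abs_of_nonneg h0]; linarith))
  nlinarith [mul_le_mul_of_nonneg_left hdn h0]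

theorem one_div_mul_one_add_one_div {d : ℝ} {n : ℕ} (hd : 0 < d) (hn : 1 ≤ n) :
    1 / ((1 + d) * (1 + 1 / ((1 + d / n) ^ n - 1))) = (1 - 1 / (1 + d / n) ^ n) / (1 + d) := by
  have h1 := one_lt_one_add_div_pow hd hn
  have h2 : 1 + 1 / ((1 + d / n) ^ n - 1) = (1 + d / n) ^ n / ((1 + d / n) ^ n - 1) := by
    rw [one_add_div (by linarith)]; ring
  rw [h2]
  generalize (1 + d / (n : ℝ)) ^ n = E at h1 ⊢
  have : E - 1 ≠ 0 := by linarith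
  have : E ≠ 0 := by linarith
  field_simp

theorem exp_neg_le_of_sum {x b : ℝ} (hx : 0 ≤ x) (m : ℕ) (hb : 0 < b)
    (h : 1 / b ≤ ∑ i ∈ Finset.range m, x ^ i / i.factorial) : Real.exp (-x) ≤ b := by
  rw [Real.exp_neg, inv_le_comm₀ (Real.exp_pos _) hb, ← one_div]
  exact h.trans (Real.sum_le_exp_of_nonneg hx m)

theorem half_le_dMon (n : ℕ) : 1 / 2 ≤ dMon n := by
  unfold dMon; split_ifs <;> norm_num

theorem QMon_eq (n : ℕ) : QMon n = 1 + coeffC (dMon n) n + dMon n :=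
  (one_add_coeffC_add _ _).symm

theorem QMon_pos {n : ℕ} (hn : 1 ≤ n) : 0 < QMon n := by
  have := half_le_dMon n
  rw [QMon_eq]
  linarith [coeffC_pos (d := dMon n) (by linarith) hn]

theorem le_one_div_QMon_of_four_le {n : ℕ} (hn : 4 ≤ n) :
    0.3178 * (1 - 0.7681 / (n : ℝ)) ≤ 1 / QMon n := by
  have hd : dMon n = 1.1461 := by
    unfold dMon; rw [if_neg (by omega), if_neg (by omega), if_neg (by omega)]
  have hn' : (4 : ℝ) ≤ n := by exact_mod_cast hn
  -- ε = 0.18 is admissible since 1.1461²/8 < 0.165.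
  have h1 := one_div_pow_le (d := 1.1461) (n := n) (by norm_num) (by omega) (ε := 0.18)
    (by norm_num) (by rw [div_le_iff₀ (by linarith)]; linarith)
  have h2 : Real.exp (-1.1461) ≤ 0.317969 :=
    exp_neg_le_of_sum (by norm_num) 10 (by norm_num)
      (by norm_num [Finset.sum_range_succ, Nat.factorial])
  rw [QMon, hd, one_div_mul_one_add_one_div (by norm_num) (by omega), le_div_iff₀ (by norm_num)]
  have hu : 0 < 1 / (n : ℝ) := by positivity
  have h3 : (1.1461 : ℝ) ^ 2 / (2 * n) = 1.1461 ^ 2 / 2 * (1 / n) := by ring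
  have h4 : (0.7681 : ℝ) / n = 0.7681 * (1 / n) := by ring
  rw [h3] at h1
  rw [h4]
  have h5 := mul_le_mul_of_nonneg_right h2
    (show 0 ≤ 1 + (1 + 0.18) * ((1.1461 : ℝ) ^ 2 / 2 * (1 / n)) by positivity)
  linarith

theorem le_one_div_QMon {n : ℕ} (hn : 1 ≤ n) : 0.25 ≤ 1 / QMon n := by
  by_cases h4 : 4 ≤ n
  · refine le_trans ?_ (le_one_div_QMon_of_four_le h4)
    have h : (4 : ℝ) ≤ n := by exact_mod_cast h4
    have : 0.7681 / (n : ℝ) ≤ 0.7681 / 4 := div_le_div_of_nonneg_left (by norm_num) (by norm_num) h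
    linarith
  · have : n = 1 ∨ n = 2 ∨ n = 3 := by omega
    rcases this with rfl | rfl | rfl <;> norm_num [QMon, dMon]

section

variable {k : ℕ}

theorem alphaMon_le (n : Fin k → ℕ) (a : Fin k) : alphaMon n ≤ 1 / QMon (n a) :=
  ciInf_le (Set.finite_range _).bddBelow a

theorem le_alphaMon [Nonempty (Fin k)] {n : Fin k → ℕ} {r : ℝ} (h : ∀ a, r ≤ 1 / QMon (n a)) :
    r ≤ alphaMon n :=
  le_ciInf h

end

section

variable (m : ℕ)

theorem alphaNmp_cardBudget : alphaNmp (cardBudget m)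
    = (1 - pNmp (cardBudget m)) / QNmp (cardBudget m) 0 := by
  rw [alphaNmp, ciInf_unique]; rfl

variable {m}

theorem pNmp_cardBudget_of_le (h : m ≤ 10) : pNmp (cardBudget m) = 0.3 := by
  rw [pNmp, if_pos ⟨0, h⟩]

theorem pNmp_cardBudget_of_lt (h : 10 < m) : pNmp (cardBudget m) = 1 / (1.9532 + 1) := by
  rw [pNmp, if_neg]
  rintro ⟨a, ha⟩
  exact absurd ha (not_le.2 h)

theorem dNmp_cardBudget_of_le (h : m ≤ 10) (a : Fin 1) : dNmp (cardBudget m) a = dNmpSmall m := by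
  rw [dNmp, if_pos ⟨0, h⟩]; rfl

theorem dNmp_cardBudget_of_lt (h : 10 < m) (a : Fin 1) : dNmp (cardBudget m) a = 1.9532 := by
  rw [dNmp, if_neg]
  rintro ⟨a, ha⟩
  exact absurd ha (not_le.2 h)

theorem pNmp_cardBudget_pos (m : ℕ) : 0 < pNmp (cardBudget m) := by
  rcases le_or_gt m 10 with h | h
  · rw [pNmp_cardBudget_of_le h]; norm_num
  · rw [pNmp_cardBudget_of_lt h]; norm_num

theorem pNmp_cardBudget_lt_one (m : ℕ) : pNmp (cardBudget m) < 1 := by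
  rcases le_or_gt m 10 with h | h
  · rw [pNmp_cardBudget_of_le h]; norm_num
  · rw [pNmp_cardBudget_of_lt h]; norm_num

theorem dNmp_cardBudget_pos (m : ℕ) (a : Fin 1) : 0 < dNmp (cardBudget m) a := by
  rcases le_or_gt m 10 with h | h
  · rw [dNmp_cardBudget_of_le h]; unfold dNmpSmall; split_ifs <;> norm_num
  · rw [dNmp_cardBudget_of_lt h]; norm_num

theorem QNmp_cardBudget_pos (hm : 1 ≤ m) : 0 < QNmp (cardBudget m) 0 := by
  have h := dNmp_cardBudget_pos m 0
  exact lt_of_lt_of_le (by linarith [coeffC_pos (n := cardBudget m 0) h hm]) (le_max_left _ _)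

theorem le_alphaNmp_of_eleven_le (hm : 11 ≤ m) :
    0.1921 * (1 - 0.7676 / (m : ℝ)) ≤ alphaNmp (cardBudget m) := by
  have hm' : (11 : ℝ) ≤ m := by exact_mod_cast hm
  have hc := coeffC_pos (d := 1.9532) (n := m) (by norm_num) (by omega)
  have hQ : QNmp (cardBudget m) 0 = 1 + coeffC 1.9532 m + 1.9532 := by
    rw [QNmp, dNmp_cardBudget_of_lt (by omega), pNmp_cardBudget_of_lt (by omega), cardBudget]
    -- Here 1/p = 1 + d, so the two terms differ by c/m.
    refine max_eq_left ?_
    have h : 0 ≤ 1 / (m : ℝ) * coeffC 1.9532 m := mul_nonneg (by positivity) hc.le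
    rw [one_div_one_div]
    linarith
  have h1 := one_div_pow_le (d := 1.9532) (n := m) (by norm_num) (by omega) (ε := 0.18)
    (by norm_num) (by rw [div_le_iff₀ (by linarith)]; linarith)
  have h2 : Real.exp (-1.9532) ≤ 0.14186 :=
    exp_neg_le_of_sum (by norm_num) 12 (by norm_num)
      (by norm_num [Finset.sum_range_succ, Nat.factorial])
  rw [alphaNmp_cardBudget, hQ, pNmp_cardBudget_of_lt (by omega), one_add_coeffC_add,
    div_eq_mul_one_div (1 - 1 / (1.9532 + 1) : ℝ),
    one_div_mul_one_add_one_div (by norm_num) (by omega), mul_div_assoc', le_div_iff₀ (by norm_num)]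
  have h3 : (1.9532 : ℝ) ^ 2 / (2 * m) = 1.9532 ^ 2 / 2 * (1 / m) := by ring
  have h4 : (0.7676 : ℝ) / m = 0.7676 * (1 / m) := by ring
  have hu : 0 < 1 / (m : ℝ) := by positivity
  rw [h3] at h1
  rw [h4]
  have h5 := mul_le_mul_of_nonneg_right h2
    (show 0 ≤ 1 + (1 + 0.18) * ((1.9532 : ℝ) ^ 2 / 2 * (1 / m)) by positivity)
  have h6 : (1 : ℝ) - 1 / (1.9532 + 1) = 1.9532 / 2.9532 := by norm_num
  rw [h6, div_mul_eq_mul_div, le_div_iff₀ (by norm_num)]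
  linarith

theorem le_alphaNmp (hm : 1 ≤ m) : 0.175 ≤ alphaNmp (cardBudget m) := by
  rcases le_or_gt m 10 with h | h
  · rw [alphaNmp_cardBudget, le_div_iff₀ (QNmp_cardBudget_pos hm), QNmp,
      dNmp_cardBudget_of_le h, pNmp_cardBudget_of_le h]
    -- Since 1 - p = 0.7, the bound 0.175 amounts to Q ≤ 4, checked for each budget up to 10.
    have : max (1 + coeffC (dNmpSmall m) m + dNmpSmall m)
        ((1 - 1 / (m : ℝ)) * coeffC (dNmpSmall m) m + 1 / 0.3) ≤ 4 := by
      refine max_le ?_ ?_ <;> interval_cases m <;> norm_num [coeffC, dNmpSmall]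
    refine (mul_le_mul_of_nonneg_left this (by norm_num)).trans (by norm_num)
  · refine le_trans ?_ (le_alphaNmp_of_eleven_le (by omega))
    have h : (11 : ℝ) ≤ m := by exact_mod_cast h
    have : 0.7676 / (m : ℝ) ≤ 0.7676 / 11 :=
      div_le_div_of_nonneg_left (by norm_num) (by norm_num) h
    linarith

end

/-! ### Expected values over the coins -/

section

variable {V : Type*} [Fintype V] {Ω : Type*} [MeasurableSpace Ω]
  {μ : Measure Ω} [IsProbabilityMeasure μ] {Z : V → Ω → Bool} {p : ℝ}

theorem measureReal_singleton_eq_coinWeight (hZ : ∀ t, Measurable (Z t)) (hind : iIndepFun Z μ)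
    (hp : ∀ t, μ.real {ω | Z t ω = true} = p) (z : V → Bool) :
    (μ.map fun ω t => Z t ω).real {z} = coinWeight p z := by
  have hmap := (iIndepFun_iff_map_fun_eq_pi_map fun t => (hZ t).aemeasurable).1 hind
  rw [hmap, measureReal_def, Measure.pi_singleton, ENNReal.toReal_prod, coinWeight]
  refine Finset.prod_congr rfl fun t _ => ?_
  rw [Measure.map_apply (hZ t) (measurableSet_singleton _), ← measureReal_def]
  have h1 : Z t ⁻¹' {true} = {ω | Z t ω = true} := rfl
  split_ifs with hz
  · rw [hz, h1, hp]
  · have h2 : Z t ⁻¹' {z t} = (Z t ⁻¹' {true})ᶜ := by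
      ext ω
      simp [Bool.eq_false_of_not_eq_true hz]
    rw [h2, probReal_compl_eq_one_sub (hZ t (measurableSet_singleton true)), h1, hp]

variable [DecidableEq V]

theorem integral_eq_sum_coinWeight (hZ : ∀ t, Measurable (Z t)) (hind : iIndepFun Z μ)
    (hp : ∀ t, μ.real {ω | Z t ω = true} = p) (F : (V → Bool) → ℝ) :
    ∫ ω, F (fun t => Z t ω) ∂μ = ∑ z, coinWeight p z * F z := by
  have hm : Measurable fun ω t => Z t ω := measurable_pi_lambda _ hZ
  rw [← integral_map (φ := fun ω t => Z t ω) (f := F) hm.aemeasurable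
    (measurable_of_countable F).aestronglyMeasurable]
  have := Measure.isProbabilityMeasure_map (μ := μ) hm.aemeasurable
  rw [integral_fintype .of_finite]
  refine Finset.sum_congr rfl fun z _ => ?_
  rw [measureReal_singleton_eq_coinWeight hZ hind hp, smul_eq_mul]

theorem integral_ite_eq_of_indepFun (hZ : ∀ t, Measurable (Z t)) (hind : iIndepFun Z μ)
    (hp : ∀ t, μ.real {ω | Z t ω = true} = p) {C : Ω → Bool} (hC : Measurable C)
    (hCZ : IndepFun C (fun ω t => Z t ω) μ) (F : (V → Bool) → ℝ) (b : ℝ) :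
    ∫ ω, (if C ω = true then F (fun t => Z t ω) else b) ∂μ
      = μ.real {ω | C ω = true} * ∑ z, coinWeight p z * F z
        + (1 - μ.real {ω | C ω = true}) * b := by
  have hm : Measurable fun ω t => Z t ω := measurable_pi_lambda _ hZ
  have hint : ∀ G : (V → Bool) → ℝ, Integrable (fun ω => G fun t => Z t ω) μ := fun G =>
    have := Measure.isProbabilityMeasure_map (μ := μ) hm.aemeasurable
    (Integrable.of_finite (μ := μ.map fun ω t => Z t ω) (f := G)).comp_measurable hm
  set φ : Bool → ℝ := fun c => if c = true then 1 else 0 with hφ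
  have hφint : ∫ ω, φ (C ω) ∂μ = μ.real {ω | C ω = true} := by
    have : (fun ω => φ (C ω)) = Set.indicator (C ⁻¹' {true}) 1 := by
      ext ω; simp [hφ, Set.indicator]
    rw [this, integral_indicator_one (hC (measurableSet_singleton true))]
    rfl
  -- In this form independence is needed for a single product.
  have h1 : ∀ ω, (if C ω = true then F (fun t => Z t ω) else b)
      = φ (C ω) * (F (fun t => Z t ω) - b) + b := by
    intro ω; simp only [hφ]; split_ifs <;> ring
  have h2 := hCZ.integral_fun_comp_mul_comp (f := φ) (g := fun z => F z - b) hC.aemeasurable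
    hm.aemeasurable (measurable_of_countable _).aestronglyMeasurable
    (measurable_of_countable _).aestronglyMeasurable
  have h3 : Integrable (fun ω => φ (C ω) * (F (fun t => Z t ω) - b)) μ := by
    refine (hint fun z => F z - b).bdd_mul (c := 1)
      ((measurable_of_countable φ).comp hC).aestronglyMeasurable (ae_of_all _ fun ω => ?_)
    simp only [hφ]; split_ifs <;> simp
  simp_rw [h1]
  rw [integral_add h3 (integrable_const b), h2, hφint, integral_const,
    integral_sub (hint F) (integrable_const b), integral_const,
    integral_eq_sum_coinWeight hZ hind hp F]
  simp only [probReal_univ, one_smul]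
  ring

end

/-! ### Arbitrary budgets -/

section

variable {k : ℕ} {n : Fin k → ℕ} {a₀ : Fin k}

theorem sum_erase_update_self (n : Fin k → ℕ) (a : Fin k) (x : ℕ) :
    ∑ b ∈ Finset.univ.erase a, Function.update n a x b = ∑ b ∈ Finset.univ.erase a, n b :=
  Finset.sum_congr rfl fun _ hb => Function.update_of_ne (Finset.ne_of_mem_erase hb) _ _

theorem reducedBudget_le (n : Fin k → ℕ) (a₀ a : Fin k) : reducedBudget n a₀ a ≤ n a := by
  rw [reducedBudget]
  by_cases h : a = a₀
  · subst h; rw [Function.update_self]; exact min_le_left _ _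
  · rw [Function.update_of_ne h]

/-- Since another part exists, lowering one budget to the sum of the others preserves any common
lower bound; with m = 1 all budgets stay positive. -/
theorem le_reducedBudget (hk : 2 ≤ k) {m : ℕ} (h : ∀ a, m ≤ n a) (a₀ a : Fin k) :
    m ≤ reducedBudget n a₀ a := by
  rw [reducedBudget]
  by_cases ha : a = a₀
  · subst ha
    obtain ⟨b, hb⟩ := nonempty_ne hk a
    rw [Function.update_self]
    exact le_min (h a) ((h b).trans (Finset.single_le_sum (f := n) (fun _ _ => Nat.zero_le _)
      (Finset.mem_erase.2 ⟨hb, Finset.mem_univ b⟩)))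
  · rw [Function.update_of_ne ha]; exact h a

/-- For a ≠ a₀, the reduced budget of `a₀` alone already dominates, because `n a₀` is the maximum.
-/
theorem reducedBudget_balanced (hmax : ∀ a, n a ≤ n a₀) (a : Fin k) :
    reducedBudget n a₀ a ≤ ∑ b ∈ Finset.univ.erase a, reducedBudget n a₀ b := by
  by_cases ha : a = a₀
  · subst ha
    rw [reducedBudget, sum_erase_update_self, Function.update_self]
    exact min_le_right _ _
  · have h1 : reducedBudget n a₀ a ≤ reducedBudget n a₀ a₀ := by
      rw [reducedBudget, Function.update_of_ne ha, Function.update_self]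
      exact le_min (hmax a) (Finset.single_le_sum (f := n) (fun _ _ => Nat.zero_le _)
        (Finset.mem_erase.2 ⟨ha, Finset.mem_univ a⟩))
    exact h1.trans (Finset.single_le_sum (fun _ _ => Nat.zero_le _)
      (Finset.mem_erase.2 ⟨fun h => ha h.symm, Finset.mem_univ _⟩))

theorem KTuple.clear_feasible {V : Type*} [DecidableEq V] {O : KTuple k V}
    (hO : KTuple.Feasible n O) (a₀ : Fin k) :
    KTuple.Feasible (reducedBudget n a₀) (O.clear a₀) := by
  intro a
  by_cases ha : a = a₀
  · simp [KTuple.clear, ha]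
  · simpa [KTuple.clear, ha, reducedBudget] using hO a

theorem quarter_le_alphaB (hk : 2 ≤ k) (hn : ∀ a, 1 ≤ n a) : 0.25 ≤ alphaB n a₀ := by
  have : Nonempty (Fin k) := ⟨a₀⟩
  exact le_alphaMon fun a => le_one_div_QMon (le_reducedBudget hk hn a₀ a)

variable {V : Type*} [DecidableEq V] {f : KTuple k V → ℝ} {order : List V}

theorem solB_feasible (hk : 2 ≤ k) (hf : KSubmodular f) (hn : ∀ a, 1 ≤ n a)
    {amax : V → (Fin k → ℝ) → Fin k} (hamax : IsArgMaxRule amax)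
    {amin : V → Finset V → (V → ℝ) → V} (hamin : IsArgMinRule amin) (hnodup : order.Nodup) :
    KTuple.Feasible n (solB f n a₀ amax amin order) := fun a =>
  (kAlg_feasible hk hf (le_reducedBudget hk hn a₀) (fun _ => half_le_dMon _) hamax hamin hnodup
    a).trans (reducedBudget_le n a₀ a)

theorem clear_le_mul_solB (hk : 2 ≤ k) (hf0 : ∀ X, 0 ≤ f X) (hf : KSubmodular f)
    (hn : ∀ a, 1 ≤ n a) (hmax : ∀ a, n a ≤ n a₀)
    {amax : V → (Fin k → ℝ) → Fin k} (hamax : IsArgMaxRule amax)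
    {amin : V → Finset V → (V → ℝ) → V} (hamin : IsArgMinRule amin) (hnodup : order.Nodup)
    (hall : ∀ t, t ∈ order) {O : KTuple k V} (hO : KTuple.Feasible n O) :
    f (O.clear a₀) ≤ 2 / alphaB n a₀ * f (solB f n a₀ amax amin order) := by
  have hn' := le_reducedBudget hk hn a₀
  have hα : 0 < alphaB n a₀ := lt_of_lt_of_le (by norm_num) (quarter_le_alphaB hk hn)
  have := le_mul_kAlg hk hf0 hf hn' (fun _ => half_le_dMon _) hamax hamin hnodup hall
    (reducedBudget_balanced hmax) (KTuple.clear_feasible hO a₀) (Q := 1 / alphaB n a₀)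
    fun a => by
      rw [← QMon_eq, le_one_div (QMon_pos (hn' a)) hα]
      exact alphaMon_le _ a
  rwa [mul_one_div] at this

theorem solA_feasible (hf : KSubmodular f) (hn : 1 ≤ n a₀)
    {amin : V → Finset V → (V → ℝ) → V} (hamin : IsArgMinRule amin) (hnodup : order.Nodup)
    (z : V → Bool) : KTuple.Feasible n (solA f n a₀ amin order z) := by
  intro a
  by_cases ha : a = a₀
  · subst ha
    simp only [solA, KTuple.single, if_true]
    exact card_pAlg_le (n := cardBudget (n a))
      (fun S T t hST htT => hf.single_marginal_anti a hST htT) hamin hn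
      (dNmp_cardBudget_pos _ 0) order hnodup z
  · simp [solA, KTuple.single, ha]

theorem single_le_mul_sum_solA [Fintype V] (hf0 : ∀ X, 0 ≤ f X) (hf : KSubmodular f)
    (hn : 1 ≤ n a₀) {amin : V → Finset V → (V → ℝ) → V} (hamin : IsArgMinRule amin)
    (hnodup : order.Nodup) (hall : ∀ t, t ∈ order) {O : Finset V} (hO : O.card ≤ n a₀) :
    f (KTuple.single a₀ O) ≤ 1 / alphaA n a₀
      * ∑ z, coinWeight (probA n a₀) z * f (solA f n a₀ amin order z) := by
  have hp := pNmp_cardBudget_lt_one (n a₀)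
  have h := one_sub_mul_le_sum_pAlg (g := fun S => f (KTuple.single a₀ S))
    (n := cardBudget (n a₀)) (d := dNmp (cardBudget (n a₀))) (O := O) (p := probA n a₀)
    (Q := QNmp (cardBudget (n a₀)) 0) (fun _ => hf0 _)
    (fun S T t hST htT => hf.single_marginal_anti a₀ hST htT) hamin hn
    (dNmp_cardBudget_pos _ 0) hO (pNmp_cardBudget_pos _) hp.le (le_max_left _ _) (le_max_right _ _)
    order hnodup hall
  rw [alphaA, alphaNmp_cardBudget, one_div_div, div_mul_eq_mul_div,
    le_div_iff₀ (sub_pos.2 hp), mul_comm]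
  exact h

end

/-! ### Combination of the two solutions -/

theorem mainTheorem4
    {k : ℕ} (hk : 2 ≤ k) {V : Type*} [Fintype V] [DecidableEq V]
    (f : KTuple k V → ℝ) (hf_nonneg : ∀ X, 0 ≤ f X) (hf : KSubmodular f)
    (n : Fin k → ℕ) (hn : ∀ a, 1 ≤ n a)
    -- the part with the largest budget
    (a₀ : Fin k) (ha₀ : ∀ a, n a ≤ n a₀)
    -- the order in which the items arrive
    (order : List V) (hnodup : order.Nodup) (hall : ∀ t, t ∈ order)
    -- tie-breaking
    (aminA : V → Finset V → (V → ℝ) → V) (haminA : IsArgMinRule aminA)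
    (amaxB : V → (Fin k → ℝ) → Fin k) (hamaxB : IsArgMaxRule amaxB)
    (aminB : V → Finset V → (V → ℝ) → V) (haminB : IsArgMinRule aminB)
    -- independent coins of the first algorithm
    {Ω : Type*} [MeasurableSpace Ω] (μ : Measure Ω) [IsProbabilityMeasure μ]
    (Z : V → Ω → Bool) (hZ_meas : ∀ t, Measurable (Z t)) (hZ_indep : iIndepFun Z μ)
    (hZ_law : ∀ t, μ.real {ω | Z t ω = true} = probA n a₀)
    -- an optimum solution
    (Sopt : KTuple k V) (hSopt : KTuple.IsOptimal f n Sopt) :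
    -- both solutions are always feasible
    (∀ z : V → Bool, KTuple.Feasible n (solA f n a₀ aminA order z)) ∧
    KTuple.Feasible n (solB f n a₀ amaxB aminB order) ∧
    -- the better of the two solutions
    1 / (1 / alphaA n a₀ + 2 / alphaB n a₀) * f Sopt
      ≤ ∫ ω, max (f (solA f n a₀ aminA order (fun t => Z t ω)))
          (f (solB f n a₀ amaxB aminB order)) ∂μ ∧
    -- the random choice between them, made by a coin independent of the others
    (∀ C : Ω → Bool, Measurable C → IndepFun C (fun ω t => Z t ω) μ →
      μ.real {ω | C ω = true} = probChooseA n a₀ →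
      1 / (1 / alphaA n a₀ + 2 / alphaB n a₀) * f Sopt
        ≤ ∫ ω, f (if C ω = true then solA f n a₀ aminA order (fun t => Z t ω)
            else solB f n a₀ amaxB aminB order) ∂μ) ∧
    -- the values of the two guarantees
    0.175 ≤ alphaA n a₀ ∧
    (11 ≤ n a₀ → 0.1921 * (1 - 0.7676 / (n a₀ : ℝ)) ≤ alphaA n a₀) ∧
    0.25 ≤ alphaB n a₀ ∧
    (∀ m : ℕ, 4 ≤ m → (∀ a, m ≤ n a) → 0.3178 * (1 - 0.7681 / (m : ℝ)) ≤ alphaB n a₀) := by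
  have hαA : 0.175 ≤ alphaA n a₀ := le_alphaNmp (hn a₀)
  have hαB : 0.25 ≤ alphaB n a₀ := quarter_le_alphaB hk hn
  have hA : 0 < 1 / alphaA n a₀ := one_div_pos.2 (lt_of_lt_of_le (by norm_num) hαA)
  have hB : 0 < 2 / alphaB n a₀ := div_pos two_pos (lt_of_lt_of_le (by norm_num) hαB)
  set EA := ∑ z, coinWeight (probA n a₀) z * f (solA f n a₀ aminA order z) with hEA
  set fB := f (solB f n a₀ amaxB aminB order)
  have hopt : f Sopt ≤ 1 / alphaA n a₀ * EA + 2 / alphaB n a₀ * fB :=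
    (hf.le_single_add_clear hf_nonneg Sopt a₀).trans (add_le_add
      (single_le_mul_sum_solA hf_nonneg hf (hn a₀) haminA hnodup hall (hSopt.1 a₀))
      (clear_le_mul_solB hk hf_nonneg hf hn ha₀ hamaxB haminB hnodup hall hSopt.1))
  have hmix : 1 / (1 / alphaA n a₀ + 2 / alphaB n a₀) * f Sopt
      ≤ probChooseA n a₀ * EA + (1 - probChooseA n a₀) * fB := by
    have hs := add_pos hA hB
    -- q is proportional to 1/α_nmp, so the mixture is the bound on f(S*) rescaled.
    have : probChooseA n a₀ * EA + (1 - probChooseA n a₀) * fB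
        = 1 / (1 / alphaA n a₀ + 2 / alphaB n a₀)
          * (1 / alphaA n a₀ * EA + 2 / alphaB n a₀ * fB) := by
      rw [probChooseA]
      generalize 1 / alphaA n a₀ = x at hs ⊢
      generalize 2 / alphaB n a₀ = y at hs ⊢
      field_simp
      ring
    rw [this]
    exact mul_le_mul_of_nonneg_left hopt (one_div_pos.2 hs).le
  refine ⟨solA_feasible hf (hn a₀) haminA hnodup, solB_feasible hk hf hn hamaxB haminB hnodup,
    ?_, ?_, hαA, le_alphaNmp_of_eleven_le, hαB, ?_⟩
  · rw [integral_eq_sum_coinWeight hZ_meas hZ_indep hZ_law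
      fun z => max (f (solA f n a₀ aminA order z)) fB]
    refine hmix.trans ?_
    have hW := coinWeight_nonneg (V := V) (pNmp_cardBudget_pos (n a₀)).le
      (pNmp_cardBudget_lt_one (n a₀)).le
    have h1 : EA ≤ ∑ z, coinWeight (probA n a₀) z * max (f (solA f n a₀ aminA order z)) fB :=
      Finset.sum_le_sum fun z _ => mul_le_mul_of_nonneg_left (le_max_left _ _) (hW z)
    have h2 : fB ≤ ∑ z, coinWeight (probA n a₀) z * max (f (solA f n a₀ aminA order z)) fB := by
      calc fB = ∑ z : V → Bool, coinWeight (probA n a₀) z * fB := by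
            rw [← Finset.sum_mul, sum_coinWeight, one_mul]
        _ ≤ _ := Finset.sum_le_sum fun z _ =>
            mul_le_mul_of_nonneg_left (le_max_right _ _) (hW z)
    have hq0 : 0 ≤ probChooseA n a₀ := div_nonneg hA.le (add_pos hA hB).le
    have hq1 : probChooseA n a₀ ≤ 1 := by
      rw [probChooseA, div_le_one (add_pos hA hB)]; linarith
    linarith [mul_le_mul_of_nonneg_left h1 hq0,
      mul_le_mul_of_nonneg_left h2 (sub_nonneg.2 hq1)]
  · intro C hC hCZ hq
    simp only [apply_ite f]
    rw [integral_ite_eq_of_indepFun hZ_meas hZ_indep hZ_law hC hCZ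
      (fun z => f (solA f n a₀ aminA order z)) fB, hq]
    exact hmix
  · intro m hm hmn
    have : Nonempty (Fin k) := ⟨a₀⟩
    refine le_alphaMon fun a => ?_
    have h1 := le_reducedBudget hk hmn a₀ a
    refine le_trans ?_ (le_one_div_QMon_of_four_le (hm.trans h1))
    have h2 : (m : ℝ) ≤ reducedBudget n a₀ a := by exact_mod_cast h1
    have h3 : (0 : ℝ) < m := by exact_mod_cast (by omega : 0 < m)
    have : 0.7681 / (reducedBudget n a₀ a : ℝ) ≤ 0.7681 / m :=
      div_le_div_of_nonneg_left (by norm_num) h3 h2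
    linarith
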